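/- Let $\hat\Sigma$ be a simplicial complex of finite subsets of a discrete set $X$ (closed under subsets, containing $\varnothing$), $m:\hat\Sigma\to(0,\infty)$ a weight, and let $\Sigma=\hat\Sigma$ if the vertices have finite total weight and $\Sigma=\hat\Sigma\setminus\{\varnothing\}$ otherwise. Write $\tau\prec\sigma$ if $\tau\subseteq\sigma$ and $|\sigma\setminus\tau|=1$ ($\sigma$ is then a coface of $\tau$), and assume that $m$ is locally summable: $\sum_{\sigma\succ\tau}m(\sigma)<\infty$ for all $\tau\in\Sigma$. Let $\delta$ be a coboundary operator on the space $C(\Sigma)$ of complex functions on $\Sigma$: $\delta\omega(\sigma)=\sum_{\tau\prec\sigma}\theta(\tau,\sigma)\omega(\tau)$ with $\theta(\tau,\sigma)=\delta 1_\tau(\sigma)\in\{\pm1\}$ for $\tau\prec\sigma$, $\delta 1_\tau(\sigma)=0$ otherwise, and $\delta\delta=0$. Let $$\partial\omega(\rho)=\frac1{m(\rho)}\sum_{\tau\succ\rho}m(\tau)\theta(\rho,\tau)\omega(\tau)$$ for those $\omega$ with $\sum_{\tau\succ\rho}m(\tau)|\omega(\tau)|<\infty$ for all $\rho\in\Sigma$.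 In $\ell^2=\ell^2(\Sigma,m)$, let $\delta_D$ be the restriction of $\delta$ to the set $D(\delta_D)=D(Q_D^+)$ of all $\omega\in\ell^2$ for which there are finitely supported $\omega_n$ with $\|\omega_n-\omega\|_2^2+\|\delta(\omega_n-\omega)\|_2^2\to0$, let $\partial_N$ be the restriction of $\partial$ to $\{\omega\in\ell^2:\partial\omega\in\ell^2\}$, and let $\Delta_D^+=\partial_N\delta_D$ with domain $\{\omega\in D(\delta_D):\delta_D\omega\in D(\partial_N)\}$; this is the operator associated with the closed form $Q_D^+(\omega)=\|\delta\omega\|_2^2$ on $D(Q_D^+)$, i.e. $\omega\in D(\Delta_D^+)$ and $\Delta_D^+\omega=g$ if and only if $\omega\in D(Q_D^+)$, $g\in\ell^2$ and $\langle\delta\omega,\delta\eta\rangle=\langle g,\eta\rangle$ for all $\eta\in D(Q_D^+)$. For $\rho\in\Sigma$ let $b_\rho$ be the graph over the link $\mathrm{lk}(\rho)=\{v\in X\setminus\rho:\{v\}\cup\rho\in\Sigma\}$ with edge weights $b_\rho(v,v')=m(\{v,v'\}\cup\rho)$ if $v\neq v'$ and $\{v,v'\}\cup\rho\in\Sigma$,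 and $b_\rho(v,v')=0$ otherwise. A connected graph $b$ is recurrent if the Markov chain $(Y_n)$ with transition probabilities $b(x,y)/\sum_z b(x,z)$ satisfies $\mathbb P(Y_k=y\text{ for some }k>0\mid Y_0=x)=1$ for all vertices $x,y$; a single vertex without neighbours counts as recurrent (the chain stays there). Then for every $\rho\in\Sigma$: if all connected components of $b_\rho$ are recurrent, then $1_\rho\in D(\delta_D)$ and $\delta_D1_\rho\in D(\delta_D)$. If moreover $\rho$ has a coface in $\Sigma$, then $\delta_D1_\rho$ is a harmonic eigenfunction of $\Delta_D^+$, i.e. $\delta_D1_\rho\neq0$, $\delta_D1_\rho\in D(\Delta_D^+)$ and $\Delta_D^+\delta_D1_\rho=0$. -/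

import Mathlib

open scoped ENNReal
open MeasureTheory ProbabilityTheory Filter Topology

noncomputable section

/-! ### Weighted graphs and recurrence -/

/-- A graph over the discrete set `X`: a symmetric, nonnegative, locally summable edge weight `b`
with vanishing diagonal. -/
structure WGraph (X : Type*) where
  b : X → X → ℝ
  nonneg : ∀ x y, 0 ≤ b x y
  symm : ∀ x y, b x y = b y x
  diag : ∀ x, b x x = 0
  summable : ∀ x, Summable (b x)

namespace WGraph

variable {X : Type*} (G : WGraph X)

/-- The total edge weight `∑_z b(x,z)` at `x`. -/
def deg (x : X) : ℝ≥0∞ := ∑' z, ENNReal.ofReal (G.b x z)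

theorem deg_ne_top (x : X) : G.deg x ≠ ∞ := by
  unfold deg
  rw [← ENNReal.ofReal_tsum_of_nonneg (G.nonneg x) (G.summable x)]
  exact ENNReal.ofReal_ne_top

open Classical in
/-- The transition probabilities `P(Y_n = y | Y_{n-1} = x) = b(x,y) / ∑_z b(x,z)`. At a vertex
without neighbours, where this quotient is `0 / 0`, the chain stays where it is. -/
def step (x : X) : PMF X :=
  if h : G.deg x = 0 then PMF.pure x
  else PMF.normalize (fun y => ENNReal.ofReal (G.b x y)) h (G.deg_ne_top x)

/-- The transition kernel of the Markov chain of the graph. -/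
def stepKernel [MeasurableSpace X] [DiscreteMeasurableSpace X] : Kernel X X where
  toFun x := (G.step x).toMeasure
  measurable' := Measurable.of_discrete

instance [MeasurableSpace X] [DiscreteMeasurableSpace X] : IsMarkovKernel G.stepKernel :=
  ⟨fun x => PMF.toMeasure.isProbabilityMeasure (G.step x)⟩

/-- The transition from the history `Y_0, …, Y_n` to `Y_{n+1}`: it depends on `Y_n` only. -/
def historyKernel [MeasurableSpace X] [DiscreteMeasurableSpace X] (n : ℕ) :
    Kernel ((i : Finset.Iic n) → (fun _ : ℕ => X) i) X :=
  G.stepKernel.comap (fun h => h ⟨n, Finset.mem_Iic.2 le_rfl⟩) (measurable_pi_apply _)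

instance [MeasurableSpace X] [DiscreteMeasurableSpace X] (n : ℕ) :
    IsMarkovKernel (G.historyKernel n) := by
  unfold historyKernel; infer_instance

/-- The law, on the space `ℕ → X` of trajectories, of the Markov chain `(Y_n)` with `Y_0 = x`. -/
def pathLaw [MeasurableSpace X] [DiscreteMeasurableSpace X] (x : X) : Measure (ℕ → X) :=
  Kernel.traj (X := fun _ : ℕ => X) G.historyKernel 0 (fun _ => x)

/-- For all `x, y`: `P(Y_k = y for some k > 0 | Y_0 = x) = 1`. (To be used for connected graphs;
`X` carries the discrete σ-algebra.) -/
def IsRecurrent : Prop :=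
  letI : MeasurableSpace X := ⊤
  haveI : DiscreteMeasurableSpace X := ⟨fun _ => trivial⟩
  ∀ x y : X, G.pathLaw x {Y | ∃ k : ℕ, 0 < k ∧ Y k = y} = 1

/-- The combinatorial graph: `x` and `y` are neighbours if `b(x,y) > 0`. -/
def toSimpleGraph : SimpleGraph X where
  Adj x y := 0 < G.b x y
  symm := ⟨fun x y h => by rw [G.symm y x]; exact h⟩
  loopless := ⟨fun x h => by rw [G.diag x] at h; exact lt_irrefl _ h⟩

/-- The restriction of a graph to a set of vertices. -/
def restrict (S : Set X) : WGraph S where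
  b x y := G.b x y
  nonneg _ _ := G.nonneg _ _
  symm _ _ := G.symm _ _
  diag _ := G.diag _
  summable x := (G.summable x).subtype S

/-- All connected components of the graph are recurrent. -/
def AllComponentsRecurrent : Prop :=
  ∀ C : G.toSimpleGraph.ConnectedComponent, (G.restrict C.supp).IsRecurrent

end WGraph

/-! ### Weighted simplicial complexes -/

/-- A simplicial complex `Σ̂` of finite subsets of `V` (with `∅ ∈ Σ̂`) and a weight `m > 0` on it
(`m` is irrelevant outside of `Σ̂`) which is locally summable: `∑_{σ ≻ τ} m(σ) < ∞` for all
nonempty simplices `τ`. -/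
structure WSComplex (V : Type*) where
  faces : Set (Finset V)
  empty_mem : ∅ ∈ faces
  down_closed : ∀ σ ∈ faces, ∀ τ, τ ⊆ σ → τ ∈ faces
  m : Finset V → ℝ
  m_pos : ∀ σ ∈ faces, 0 < m σ
  locally_summable : ∀ τ ∈ faces, τ.Nonempty →
    Summable (fun σ : {σ : Finset V // σ ∈ faces ∧ τ ⊆ σ ∧ σ.card = τ.card + 1} => m σ)

namespace WSComplex

variable {V : Type*} (K : WSComplex V)

/-- The set `Σ` of simplices that is worked with: it is `Σ̂` if the vertices have finite total
weight, and `Σ̂ \ {∅}` otherwise. -/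
def simplices : Set (Finset V) :=
  {σ | σ ∈ K.faces ∧ (σ = ∅ → Summable (fun v : {v : V // {v} ∈ K.faces} => K.m {v.1}))}

/-- `Σ` as a type. -/
abbrev Simplex : Type _ := {σ : Finset V // σ ∈ K.simplices}

/-- `τ ≺ σ`: `τ` is a face of `σ`, and `σ` is a coface of `τ`. -/
def Face (τ σ : K.Simplex) : Prop := τ.1 ⊆ σ.1 ∧ σ.1.card = τ.1.card + 1

theorem finite_faces (σ : K.Simplex) : {τ : K.Simplex | K.Face τ σ}.Finite := by
  refine Set.Finite.of_finite_image (f := Subtype.val) ?_ Subtype.val_injective.injOn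
  refine (σ.1.powerset.finite_toSet).subset ?_
  rintro _ ⟨τ, hτ, rfl⟩
  simpa using hτ.1

/-- The finite set of faces of `σ`. -/
def facesOf (σ : K.Simplex) : Finset K.Simplex := (K.finite_faces σ).toFinset

/-- `C(Σ)`. -/
abbrev Fn : Type _ := K.Simplex → ℂ

/-- The characteristic function `1_τ`. -/
def ind (τ : K.Simplex) : K.Fn := Set.indicator {τ} (fun _ => 1)

/-- `‖ω‖₂² = ∑_Σ m |ω|²`, with values in `[0, ∞]`. -/
def normSq (ω : K.Fn) : ℝ≥0∞ := ∑' σ : K.Simplex, ENNReal.ofReal (K.m σ) * ‖ω σ‖ₑ ^ 2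

theorem normSq_zero : K.normSq 0 = 0 := by simp [normSq]

theorem normSq_smul (c : ℂ) (ω : K.Fn) : K.normSq (c • ω) = ‖c‖ₑ ^ 2 * K.normSq ω := by
  simp only [normSq, ← ENNReal.tsum_mul_left, Pi.smul_apply, enorm_smul, mul_pow]
  exact tsum_congr fun _ => by ring

theorem normSq_add_le (ω η : K.Fn) :
    K.normSq (ω + η) ≤ 2 * (K.normSq ω + K.normSq η) := by
  simp only [normSq, ← ENNReal.tsum_add, ← ENNReal.tsum_mul_left]
  refine ENNReal.tsum_le_tsum fun σ => ?_
  have h : ‖ω σ + η σ‖ₑ ^ 2 ≤ 2 * (‖ω σ‖ₑ ^ 2 + ‖η σ‖ₑ ^ 2) := by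
    simp only [enorm_eq_nnnorm]
    norm_cast
    have h1 : ‖ω σ + η σ‖₊ ^ 2 ≤ (‖ω σ‖₊ + ‖η σ‖₊) ^ 2 := by
      gcongr; exact nnnorm_add_le _ _
    exact h1.trans (add_sq_le)
  calc ENNReal.ofReal (K.m σ) * ‖(ω + η) σ‖ₑ ^ 2
      ≤ ENNReal.ofReal (K.m σ) * (2 * (‖ω σ‖ₑ ^ 2 + ‖η σ‖ₑ ^ 2)) := by
        gcongr; exact h
    _ = _ := by ring

/-- `ℓ² = ℓ²(Σ, m)`. -/
def l2 : Submodule ℂ K.Fn where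
  carrier := {ω | K.normSq ω < ∞}
  zero_mem' := by simp [normSq_zero]
  add_mem' {ω η} h1 h2 := lt_of_le_of_lt (K.normSq_add_le ω η)
    (ENNReal.mul_lt_top (by simp) (ENNReal.add_lt_top.2 ⟨h1, h2⟩))
  smul_mem' c ω h := by
    change K.normSq (c • ω) < ∞
    rw [normSq_smul]
    exact ENNReal.mul_lt_top (by simp) h

/-- The inner product `⟨f, g⟩ = ∑_Σ m f ḡ` of `ℓ²`. -/
def l2Inner (f g : K.Fn) : ℂ := ∑' σ : K.Simplex, (K.m σ : ℂ) * f σ * (starRingEnd ℂ) (g σ)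

/-- A coboundary operator on `Σ`: a linear operator `δ` on `C(Σ)` with `δ 1_τ(σ) ∈ {±1, 0}`,
`δ 1_τ(σ) ≠ 0` iff `τ ≺ σ`, and `δδ = 0`, which acts by
`δω(σ) = ∑_{τ ≺ σ} θ(τ,σ) ω(τ)` with `θ(τ,σ) = δ 1_τ(σ)`. -/
structure Coboundary where
  op : K.Fn →ₗ[ℂ] K.Fn
  values : ∀ τ σ, op (K.ind τ) σ = 1 ∨ op (K.ind τ) σ = -1 ∨ op (K.ind τ) σ = 0
  ne_zero_iff : ∀ τ σ, op (K.ind τ) σ ≠ 0 ↔ K.Face τ σ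
  op_op : ∀ ω, op (op ω) = 0
  action : ∀ ω σ, op ω σ = ∑ τ ∈ K.facesOf σ, op (K.ind τ) σ * ω τ

namespace Coboundary

variable {K} (δ : K.Coboundary)

/-- `θ(τ,σ) = δ 1_τ(σ)`. -/
def θ (τ σ : K.Simplex) : ℂ := δ.op (K.ind τ) σ

theorem norm_θ_le (τ σ : K.Simplex) : ‖δ.θ τ σ‖ ≤ 1 := by
  unfold θ
  rcases δ.values τ σ with h | h | h <;> simp [h]

end Coboundary

/-- `D(∂)`: the functions `ω` with `∑_{τ ≻ ρ} m(τ) |ω(τ)| < ∞` for all `ρ`. -/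
def domBoundary : Submodule ℂ K.Fn where
  carrier := {ω | ∀ ρ, Summable (fun τ : {τ : K.Simplex // K.Face ρ τ} => K.m τ.1 * ‖ω τ.1‖)}
  zero_mem' ρ := by simp [summable_zero]
  add_mem' {ω η} h1 h2 ρ := by
    refine Summable.of_nonneg_of_le (fun τ => ?_) (fun τ => ?_) ((h1 ρ).add (h2 ρ))
    · exact mul_nonneg (K.m_pos _ τ.1.2.1).le (norm_nonneg _)
    · rw [← mul_add]
      exact mul_le_mul_of_nonneg_left (norm_add_le _ _) (K.m_pos _ τ.1.2.1).le
  smul_mem' c ω h ρ := by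
    refine ((h ρ).mul_left ‖c‖).congr fun τ => ?_
    simp only [Pi.smul_apply, norm_smul]; ring

namespace Coboundary

variable {K} (δ : K.Coboundary)

theorem summable_boundary {ω : K.Fn} (hω : ω ∈ K.domBoundary) (ρ : K.Simplex) :
    Summable (fun τ : {τ : K.Simplex // K.Face ρ τ} => (K.m τ.1 : ℂ) * δ.θ ρ τ.1 * ω τ.1) := by
  refine Summable.of_norm_bounded (hω ρ) fun τ => ?_
  have hm := (K.m_pos _ τ.1.2.1).le
  rw [norm_mul, norm_mul, Complex.norm_real, Real.norm_of_nonneg hm]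
  have := δ.norm_θ_le ρ τ.1
  have h2 : K.m τ.1 * ‖δ.θ ρ τ.1‖ ≤ K.m τ.1 := mul_le_of_le_one_right hm this
  exact mul_le_mul_of_nonneg_right h2 (norm_nonneg _)

/-- The boundary operator `∂ : D(∂) → C(Σ)`,
`∂ω(ρ) = m(ρ)⁻¹ ∑_{τ ≻ ρ} m(τ) θ(ρ,τ) ω(τ)`. -/
def boundary : K.Fn →ₗ.[ℂ] K.Fn where
  domain := K.domBoundary
  toFun :=
    { toFun := fun ω ρ => (K.m ρ : ℂ)⁻¹ *
        ∑' τ : {τ : K.Simplex // K.Face ρ τ}, (K.m τ.1 : ℂ) * δ.θ ρ τ.1 * ω.1 τ.1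
      map_add' := fun ω η => by
        funext ρ
        simp only [Pi.add_apply, Submodule.coe_add]
        rw [← mul_add, ← (δ.summable_boundary ω.2 ρ).tsum_add (δ.summable_boundary η.2 ρ)]
        congr 1
        exact tsum_congr fun _ => by ring
      map_smul' := fun c ω => by
        funext ρ
        simp only [Pi.smul_apply, Submodule.coe_smul, smul_eq_mul, RingHom.id_apply]
        rw [mul_left_comm]
        congr 1
        rw [← tsum_mul_left]
        exact tsum_congr fun _ => by ring }

/-- The quadratic form `𝒬⁺(ω) = ∑_Σ m |δω|²`. -/
def formPlus (ω : K.Fn) : ℝ≥0∞ := K.normSq (δ.op ω)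

/-- The domain `D(Q⁺_D)` of the form with Dirichlet boundary conditions: those `ω ∈ ℓ²` for which
there are finitely supported `ω_n` with `‖ω_n - ω‖₂² + 𝒬⁺(ω_n - ω) → 0`. -/
def domD : Submodule ℂ K.Fn where
  carrier := {ω | ω ∈ K.l2 ∧ ∃ u : ℕ → K.Fn, (∀ n, (Function.support (u n)).Finite) ∧
    Tendsto (fun n => K.normSq (u n - ω) + δ.formPlus (u n - ω)) atTop (𝓝 0)}
  zero_mem' := ⟨K.l2.zero_mem, fun _ => 0, by simp, by simp [formPlus, normSq_zero]⟩
  add_mem' := by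
    rintro ω η ⟨h1, u, hu, hu'⟩ ⟨h2, w, hw, hw'⟩
    refine ⟨K.l2.add_mem h1 h2, fun n => u n + w n, fun n => ?_, ?_⟩
    · exact ((hu n).union (hw n)).subset (Function.support_add _ _)
    · have h := ENNReal.Tendsto.const_mul (a := 2) (hu'.add hw') (Or.inr (by simp))
      simp only [add_zero, mul_zero] at h
      refine tendsto_of_tendsto_of_tendsto_of_le_of_le tendsto_const_nhds h
        (fun _ => zero_le) fun n => ?_
      have e : u n + w n - (ω + η) = (u n - ω) + (w n - η) := by abel
      simp only [formPlus, e, map_add]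
      refine (add_le_add (K.normSq_add_le _ _) (K.normSq_add_le _ _)).trans (le_of_eq ?_)
      ring
  smul_mem' := by
    rintro c ω ⟨h1, u, hu, hu'⟩
    refine ⟨K.l2.smul_mem c h1, fun n => c • u n, fun n => ?_, ?_⟩
    · exact (hu n).subset (Function.support_const_smul_subset _ _)
    · have h := ENNReal.Tendsto.const_mul (a := ‖c‖ₑ ^ 2) hu' (Or.inr (by simp))
      simp only [mul_zero] at h
      refine h.congr fun n => ?_
      simp only [formPlus, ← smul_sub, map_smul, normSq_smul]
      ring

/-- `δ_D`: the restriction of `δ` to `D(Q⁺_D)`. -/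
def coboundaryD : K.Fn →ₗ.[ℂ] K.Fn := δ.op.toPMap δ.domD

/-- `∂_N`: the restriction of `∂` to `D(Q⁻_N)`, i.e. to those `ω ∈ ℓ²` with
`𝒬⁻(ω) = ∑_Σ m |∂ω|² < ∞`. -/
def boundaryN : K.Fn →ₗ.[ℂ] K.Fn :=
  δ.boundary.domRestrict (K.l2 ⊓ (K.l2.comap δ.boundary.toFun).map δ.boundary.domain.subtype)

/-- The up-Laplacian `Δ⁺_D = ∂_N δ_D`, with its natural domain
`{ω ∈ D(δ_D) | δ_D ω ∈ D(∂_N)}`. -/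
def upLaplacianD : K.Fn →ₗ.[ℂ] K.Fn :=
  δ.boundaryN.comp
    (δ.coboundaryD.domRestrict
      ((δ.boundaryN.domain.comap δ.coboundaryD.toFun).map δ.coboundaryD.domain.subtype))
    (by
      rintro ⟨x, ⟨y, hy, rfl⟩, hx⟩
      exact hy)

/-- The graph of the operator in `ℓ²` that is associated with the closed form `Q⁺_D`:
`ω ∈ D(Q⁺_D)`, `g ∈ ℓ²` and `Q⁺_D(ω, η) = ⟨g, η⟩` for all `η ∈ D(Q⁺_D)`. -/
def formOperatorGraph : Set (K.Fn × K.Fn) :=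
  {p | p.1 ∈ δ.domD ∧ p.2 ∈ K.l2 ∧
    ∀ η ∈ δ.domD, K.l2Inner (δ.op p.1) (δ.op η) = K.l2Inner p.2 η}

end Coboundary

/-! ### Links -/

open Classical in
/-- The link `lk(ρ)`: the vertices `v` with `v ∪ ρ ≻ ρ`. -/
def link (ρ : K.Simplex) : Set V := {v | v ∉ ρ.1 ∧ insert v ρ.1 ∈ K.faces}

open Classical in
/-- The edge weights of the link: `b_ρ(v,v') = m(vv'ρ)` if `v ≠ v'` and `vv'ρ` is a simplex,
and `b_ρ(v,v') = 0` otherwise. -/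
def linkWeight (ρ : K.Simplex) (v v' : K.link ρ) : ℝ :=
  if v ≠ v' ∧ insert v.1 (insert v'.1 ρ.1) ∈ K.faces then K.m (insert v.1 (insert v'.1 ρ.1)) else 0

theorem linkWeight_summable (ρ : K.Simplex) (v : K.link ρ) : Summable (K.linkWeight ρ v) := by
  classical
  let S : Set (K.link ρ) := {v' | v ≠ v' ∧ insert v.1 (insert v'.1 ρ.1) ∈ K.faces}
  have hS : K.linkWeight ρ v =
      S.indicator (fun v' => K.m (insert v.1 (insert v'.1 ρ.1))) := by
    funext v'
    simp only [linkWeight, Set.indicator, S]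
    congr
  rw [hS, ← summable_subtype_iff_indicator]
  have hsum := K.locally_summable (insert v.1 ρ.1) v.2.2 (Finset.insert_nonempty _ _)
  let f : S → {σ : Finset V // σ ∈ K.faces ∧ insert v.1 ρ.1 ⊆ σ ∧
      σ.card = (insert v.1 ρ.1).card + 1} := fun v' =>
    ⟨insert v'.1.1 (insert v.1 ρ.1), by
      rw [Finset.insert_comm]; exact v'.2.2, Finset.subset_insert _ _, by
      apply Finset.card_insert_of_notMem
      intro h
      rcases Finset.mem_insert.1 h with h | h
      · exact v'.2.1 (Subtype.ext h.symm)
      · exact v'.1.2.1 h⟩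
  have hf : Function.Injective f := by
    intro x y h
    have h1 : insert x.1.1 (insert v.1 ρ.1) = insert y.1.1 (insert v.1 ρ.1) :=
      congrArg Subtype.val h
    have h2 : x.1.1 ∈ insert y.1.1 (insert v.1 ρ.1) := h1 ▸ Finset.mem_insert_self _ _
    rcases Finset.mem_insert.1 h2 with h2 | h2
    · exact Subtype.ext (Subtype.ext h2)
    · rcases Finset.mem_insert.1 h2 with h2 | h2
      · exact absurd (Subtype.ext h2.symm) x.2.1
      · exact absurd h2 x.1.2.1
  refine (hsum.comp_injective hf).congr fun x => ?_
  simp only [Function.comp_apply, f]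
  rw [Finset.insert_comm]

/-- The link `lk(ρ)` as a graph, with the edge weights `b_ρ`. -/
def linkGraph (ρ : K.Simplex) : WGraph (K.link ρ) where
  b := K.linkWeight ρ
  nonneg v v' := by
    unfold linkWeight
    split_ifs with h
    · exact (K.m_pos _ h.2).le
    · exact le_rfl
  symm v v' := by
    classical
    unfold linkWeight
    rw [Finset.insert_comm]
    simp only [ne_comm]
  diag v := by simp [linkWeight]
  summable := K.linkWeight_summable ρ

end WSComplex

/-- `f` is a harmonic eigenfunction of `T`: a nonzero element of the domain with `T f = 0`. -/
def IsHarmonicEigenfunction {E : Type*} [AddCommGroup E] [Module ℂ E] (T : E →ₗ.[ℂ] E) (f : E) :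
    Prop :=
  f ≠ 0 ∧ ∃ h : f ∈ T.domain, T ⟨f, h⟩ = 0

end

/-! Since `δδ = 0`, the function `δ1_ρ` is harmonic once it lies in the form domain, so the point is
to approximate it there by finitely supported functions. It lives on the cofaces `v ∪ ρ`, that is,
on the vertices of the link, so it can be multiplied by a finitely supported `φ` on the link
(`cutoff`). On `σ = vv'ρ` the identity `δδ1_ρ(σ) = 0` makes the two contributions cancel when `φ` is
constant, so `|δ(φ·δ1_ρ)(σ)| = |φ(v) - φ(v')|` and the form is bounded by the energy of `φ` on the
link graph (`formPlus_cutoff_le`). The cofaces of `ρ` have finite total mass, so the `ℓ²` error is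
small if `φ = 1` on a large finite set.

It remains to see that finite sets have capacity zero when all components are recurrent
(`AllComponentsRecurrent.capacityZero`). The probability `h_n` of hitting `x` within `n` steps is
subharmonic off `x`, and Green's formula bounds its energy by `2 deg(x)` times the probability of no
return to `x` within `n + 1` steps, which tends to `0`. Truncation makes the support finite,
extension by zero passes from components to the graph, and maxima pass from points to finite sets.

That `Δ⁺_D` is the form operator is checked on indicators and extended by density and
Cauchy–Schwarz. -/

theorem PMF.lintegral_toMeasure_eq_tsum {α : Type*} [MeasurableSpace α]
    [DiscreteMeasurableSpace α] (p : PMF α) (f : α → ℝ≥0∞) :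
    ∫⁻ a, f a ∂p.toMeasure = ∑' a, p a * f a := by
  have hp : p.toMeasure = Measure.sum fun a => p a • Measure.dirac a := by
    ext s hs
    rw [Measure.sum_apply _ hs, p.toMeasure_apply hs]
    refine tsum_congr fun a => ?_
    by_cases ha : a ∈ s <;> simp [Measure.dirac_apply' _ hs, ha]
  rw [hp, lintegral_sum_measure]
  refine tsum_congr fun a => ?_
  rw [lintegral_smul_measure, lintegral_dirac, smul_eq_mul]

/-! ### Hitting probabilities and the law of the Markov chain. -/

namespace WGraph

variable {X : Type*} (G : WGraph X)

/-- The mean of `f` after one step of the Markov chain started at `x`. -/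
noncomputable def avg (f : X → ℝ≥0∞) (x : X) : ℝ≥0∞ := ∑' y, G.step x y * f y

theorem avg_mono {f g : X → ℝ≥0∞} (h : f ≤ g) (x : X) : G.avg f x ≤ G.avg g x :=
  ENNReal.tsum_le_tsum fun y => mul_le_mul_right (h y) _

theorem avg_le_one {f : X → ℝ≥0∞} (h : f ≤ 1) (x : X) : G.avg f x ≤ 1 := by
  refine (G.avg_mono h x).trans ?_
  simp [avg, (G.step x).tsum_coe]

theorem ofReal_b_eq_zero {x : X} (h : G.deg x = 0) (y : X) : ENNReal.ofReal (G.b x y) = 0 :=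
  ENNReal.tsum_eq_zero.1 h y

theorem step_apply {x : X} (h : G.deg x ≠ 0) (y : X) :
    G.step x y = ENNReal.ofReal (G.b x y) * (G.deg x)⁻¹ := by
  unfold step
  rw [dif_neg h]
  exact PMF.normalize_apply _ _ _

/-- Multiplying by the degree clears the denominator. At an isolated vertex both sides vanish, so
the convention that the chain stays there does no harm. -/
theorem deg_mul_avg (f : X → ℝ≥0∞) (x : X) :
    G.deg x * G.avg f x = ∑' y, ENNReal.ofReal (G.b x y) * f y := by
  by_cases h : G.deg x = 0
  · simp [h, G.ofReal_b_eq_zero h]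
  · rw [avg, ← ENNReal.tsum_mul_left]
    refine tsum_congr fun y => ?_
    rw [G.step_apply h, ← mul_assoc, mul_left_comm,
      ENNReal.mul_inv_cancel h (G.deg_ne_top x), mul_one]

open Classical in
/-- The probability that the chain started at `y` visits `x` at one of the times `0, …, n`. -/
noncomputable def hitWithin (x : X) : ℕ → X → ℝ≥0∞
  | 0, y => if y = x then 1 else 0
  | n + 1, y => if y = x then 1 else G.avg (hitWithin x n) y

theorem hitWithin_self (x : X) (n : ℕ) : G.hitWithin x n x = 1 := by
  cases n <;> simp [hitWithin]

theorem hitWithin_succ {x y : X} (h : y ≠ x) (n : ℕ) :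
    G.hitWithin x (n + 1) y = G.avg (G.hitWithin x n) y := by
  simp [hitWithin, h]

theorem hitWithin_le_one (x : X) (n : ℕ) : G.hitWithin x n ≤ 1 := by
  induction n with
  | zero => intro y; simp only [hitWithin]; split_ifs <;> simp
  | succ n ih =>
    intro y
    by_cases h : y = x
    · simp [h, hitWithin_self]
    · rw [hitWithin_succ _ h]; exact G.avg_le_one ih y

/-- With `hitWithin_succ` this gives subharmonicity off `x`: `h_n ≤ h_{n+1} = avg h_n`. -/
theorem hitWithin_le_succ (x : X) (n : ℕ) : G.hitWithin x n ≤ G.hitWithin x (n + 1) := by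
  induction n with
  | zero =>
    intro y
    by_cases h : y = x
    · simp [h, hitWithin_self]
    · simp [hitWithin, h]
  | succ n ih =>
    intro y
    by_cases h : y = x
    · simp [h, hitWithin_self]
    · rw [hitWithin_succ _ h, hitWithin_succ _ h]; exact G.avg_mono ih y

section Trajectories

variable [MeasurableSpace X] [DiscreteMeasurableSpace X]

theorem measurableSet_visit (x : X) (p : ℕ → Prop) :
    MeasurableSet {Y : ℕ → X | ∃ k, p k ∧ Y k = x} := by
  have : {Y : ℕ → X | ∃ k, p k ∧ Y k = x} = ⋃ k ∈ {k | p k}, (fun Y => Y k) ⁻¹' {x} := by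
    ext; simp
  rw [this]
  exact MeasurableSet.biUnion (Set.to_countable _) fun k _ =>
    measurable_pi_apply k (measurableSet_singleton x)

/-- The law of the trajectory continuing the history `u` projects to the Dirac mass at `u` on the
times up to `a`. -/
theorem traj_eval_ne (a : ℕ) (u : (i : Finset.Iic a) → (fun _ : ℕ => X) i) :
    Kernel.traj (X := fun _ : ℕ => X) G.historyKernel a u
      {Y | Y a ≠ u ⟨a, Finset.mem_Iic.2 le_rfl⟩} = 0 := by
  have h := Kernel.traj_map_frestrictLe_apply (X := fun _ : ℕ => X)
    (κ := G.historyKernel) a a u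
  rw [Kernel.partialTraj_self, Kernel.id_apply] at h
  have hm : MeasurableSet {v : (i : Finset.Iic a) → (fun _ : ℕ => X) i |
      v ⟨a, Finset.mem_Iic.2 le_rfl⟩ ≠ u ⟨a, Finset.mem_Iic.2 le_rfl⟩} :=
    (measurable_pi_apply (X := fun i : Finset.Iic a => X)
      (⟨a, Finset.mem_Iic.2 le_rfl⟩ : Finset.Iic a)) (MeasurableSet.of_discrete (s := {y | y ≠ _}))
  have h2 := congrArg (fun μ => μ {v | v ⟨a, Finset.mem_Iic.2 le_rfl⟩ ≠
    u ⟨a, Finset.mem_Iic.2 le_rfl⟩}) h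
  rw [Measure.map_apply (by fun_prop) hm, Measure.dirac_apply' _ hm] at h2
  simpa using h2

/-- The Markov property for one step: disintegrate over the history up to time `a + 1`, whose last
coordinate has the law of `step`. An upper bound is all that is needed. -/
theorem traj_le_avg (a : ℕ) (u : (i : Finset.Iic a) → (fun _ : ℕ => X) i) (A : Set (ℕ → X))
    (hA : MeasurableSet A) (f : X → ℝ≥0∞)
    (h : ∀ v : (i : Finset.Iic (a + 1)) → (fun _ : ℕ => X) i,
      Kernel.traj (X := fun _ : ℕ => X) G.historyKernel (a + 1) v A ≤
        f (v ⟨a + 1, Finset.mem_Iic.2 le_rfl⟩)) :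
    Kernel.traj (X := fun _ : ℕ => X) G.historyKernel a u A ≤
      G.avg f (u ⟨a, Finset.mem_Iic.2 le_rfl⟩) := by
  have hmap := Kernel.map_partialTraj_succ_self (X := fun _ : ℕ => X) (κ := G.historyKernel) a
  have hf : Measurable f := Measurable.of_discrete
  rw [← Kernel.traj_comp_partialTraj (X := fun _ : ℕ => X) (κ := G.historyKernel) (Nat.le_succ a),
    Kernel.comp_apply' _ _ _ hA]
  calc _ ≤ ∫⁻ v, f (v ⟨a + 1, Finset.mem_Iic.2 le_rfl⟩)
        ∂(Kernel.partialTraj (X := fun _ : ℕ => X) G.historyKernel a (a + 1) u) :=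
        lintegral_mono h
    _ = ∫⁻ y, f y ∂(G.historyKernel a u) := by
        rw [← hmap, Kernel.map_apply _ (by fun_prop), lintegral_map hf (by fun_prop)]
    _ = _ := by
        rw [avg, ← PMF.lintegral_toMeasure_eq_tsum]
        rfl

/-- Times `a + 1, …, a + n + 1` are the times `0, …, n` of the chain restarted at `Y_{a+1}`; hence
the outer `avg` and the shift by one. -/
theorem traj_visit_le (x : X) (n : ℕ) : ∀ (a : ℕ) (u : (i : Finset.Iic a) → (fun _ : ℕ => X) i),
    Kernel.traj (X := fun _ : ℕ => X) G.historyKernel a u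
        {Y | ∃ k, (a < k ∧ k ≤ a + (n + 1)) ∧ Y k = x} ≤
      G.avg (G.hitWithin x n) (u ⟨a, Finset.mem_Iic.2 le_rfl⟩) := by
  induction n with
  | zero =>
    intro a u
    refine G.traj_le_avg a u _ (measurableSet_visit x _) _ fun v => ?_
    by_cases hv : v ⟨a + 1, Finset.mem_Iic.2 le_rfl⟩ = x
    · rw [hv, hitWithin_self]; exact prob_le_one
    · refine le_trans ?_ zero_le
      rw [← G.traj_eval_ne (a + 1) v]
      refine measure_mono ?_
      rintro Y ⟨k, hk, rfl⟩
      obtain rfl : k = a + 1 := by omega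
      exact fun h => hv h.symm
  | succ n ih =>
    intro a u
    refine G.traj_le_avg a u _ (measurableSet_visit x _) _ fun v => ?_
    by_cases hv : v ⟨a + 1, Finset.mem_Iic.2 le_rfl⟩ = x
    · rw [hv, hitWithin_self]; exact prob_le_one
    · rw [hitWithin_succ _ hv]
      refine le_trans ?_ (ih (a + 1) v)
      -- Up to the null event that `Y_{a+1}` differs from its prescribed value, which is not `x`, a
      -- visit must occur after time `a + 1`.
      have hu := measure_union_le {Y : ℕ → X | Y (a + 1) ≠ v ⟨a + 1, Finset.mem_Iic.2 le_rfl⟩}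
        {Y : ℕ → X | ∃ k, (a + 1 < k ∧ k ≤ a + 1 + (n + 1)) ∧ Y k = x}
        (μ := Kernel.traj (X := fun _ : ℕ => X) G.historyKernel (a + 1) v)
      rw [G.traj_eval_ne (a + 1) v, zero_add] at hu
      refine le_trans (measure_mono ?_) hu
      rintro Y ⟨k, hk, rfl⟩
      by_cases hka : k = a + 1
      · subst hka; exact Or.inl fun h => hv h.symm
      · exact Or.inr ⟨k, by omega, rfl⟩

theorem pathLaw_return_le (x : X) :
    G.pathLaw x {Y | ∃ k : ℕ, 0 < k ∧ Y k = x} ≤ ⨆ n, G.avg (G.hitWithin x n) x := by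
  have h : {Y : ℕ → X | ∃ k : ℕ, 0 < k ∧ Y k = x} =
      ⋃ n, {Y | ∃ k, (0 < k ∧ k ≤ 0 + (n + 1)) ∧ Y k = x} := by
    ext Y
    simp only [Set.mem_ofPred_eq, Set.mem_iUnion]
    exact ⟨fun ⟨k, hk, h⟩ => ⟨k, k, ⟨hk, by omega⟩, h⟩, fun ⟨_, k, hk, h⟩ => ⟨k, hk.1, h⟩⟩
  rw [h, Monotone.measure_iUnion]
  · exact iSup_mono fun n => G.traj_visit_le x n 0 _
  · rintro n m hnm Y ⟨k, hk, h⟩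
    exact ⟨k, ⟨hk.1, by omega⟩, h⟩

end Trajectories

/-- The only consequence of recurrence that is used: the return to the starting point is almost
sure. -/
theorem IsRecurrent.iSup_avg_hitWithin {G : WGraph X} (h : G.IsRecurrent) (x : X) :
    ⨆ n, G.avg (G.hitWithin x n) x = 1 := by
  let _ : MeasurableSpace X := ⊤
  have : DiscreteMeasurableSpace X := ⟨fun _ => trivial⟩
  refine le_antisymm (iSup_le fun n => G.avg_le_one (G.hitWithin_le_one x n) x) ?_
  rw [← h x x]
  exact G.pathLaw_return_le x

end WGraph

/-! ### Energy, Green's formula and capacity zero. -/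

namespace WGraph

variable {X : Type*} (G : WGraph X)

/-- The energy of `φ`; every edge is counted twice. -/
noncomputable def energy (φ : X → ℝ) : ℝ≥0∞ :=
  ∑' p : X × X, ENNReal.ofReal (G.b p.1 p.2 * (φ p.1 - φ p.2) ^ 2)

/-- The degree is a stationary measure of the chain, by symmetry of `b`. -/
theorem tsum_deg_mul_avg (f : X → ℝ≥0∞) :
    ∑' x, G.deg x * G.avg f x = ∑' x, G.deg x * f x := by
  simp only [deg_mul_avg]
  rw [ENNReal.tsum_comm]
  refine tsum_congr fun x => ?_
  rw [ENNReal.tsum_mul_right, deg]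
  simp only [G.symm x]

/-- Expand the square. With the cross term on the left, everything is a sum in `[0, ∞]` and no
summability is required. -/
theorem energy_add_tsum (φ : X → ℝ) (hφ : 0 ≤ φ) :
    G.energy φ + 2 * ∑' y, ENNReal.ofReal (φ y) *
        (G.deg y * G.avg (fun z => ENNReal.ofReal (φ z)) y) =
      2 * ∑' y, G.deg y * ENNReal.ofReal (φ y) ^ 2 := by
  have h1 : ∑' p : X × X, ENNReal.ofReal (G.b p.1 p.2) * ENNReal.ofReal (φ p.1) ^ 2 =
      ∑' y, G.deg y * ENNReal.ofReal (φ y) ^ 2 := by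
    rw [ENNReal.tsum_prod']
    refine tsum_congr fun y => ?_
    rw [deg, ← ENNReal.tsum_mul_right]
  have h2 : ∑' p : X × X, ENNReal.ofReal (G.b p.1 p.2) * ENNReal.ofReal (φ p.2) ^ 2 =
      ∑' y, G.deg y * ENNReal.ofReal (φ y) ^ 2 := by
    rw [← h1, ← (Equiv.prodComm X X).tsum_eq]
    simp [G.symm]
  have h3 : ∑' p : X × X, ENNReal.ofReal (φ p.1) *
        (ENNReal.ofReal (G.b p.1 p.2) * ENNReal.ofReal (φ p.2)) =
      ∑' y, ENNReal.ofReal (φ y) * (G.deg y * G.avg (fun z => ENNReal.ofReal (φ z)) y) := by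
    rw [ENNReal.tsum_prod']
    refine tsum_congr fun y => ?_
    rw [deg_mul_avg, ← ENNReal.tsum_mul_left]
  rw [two_mul (∑' y, G.deg y * _)]
  nth_rw 1 [← h1]
  rw [← h2, ← h3, energy, ← ENNReal.tsum_mul_left, ← ENNReal.tsum_add, ← ENNReal.tsum_add]
  refine tsum_congr fun p => ?_
  have hb := G.nonneg p.1 p.2
  have hy := hφ p.1
  have hz := hφ p.2
  simp only [Pi.zero_apply] at hy hz
  rw [← ENNReal.ofReal_mul hb, ← ENNReal.ofReal_mul hy, ← ENNReal.ofReal_pow hy,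
    ← ENNReal.ofReal_pow hz, ← ENNReal.ofReal_mul hb, ← ENNReal.ofReal_mul hb,
    ← ENNReal.ofReal_ofNat 2, ← ENNReal.ofReal_mul (by positivity),
    ← ENNReal.ofReal_add (by positivity) (by positivity),
    ← ENNReal.ofReal_add (by positivity) (by positivity)]
  congr 1
  ring

/-- Green's formula for a function that is subharmonic off `x` and attains its maximum `1` at
`x`. -/
theorem energy_add_le (φ : X → ℝ) (hφ : 0 ≤ φ) (hφ1 : φ ≤ 1) {x : X} (hx : φ x = 1)
    (hs : ∑' y, G.deg y * ENNReal.ofReal (φ y) ≠ ∞)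
    (hsub : ∀ y, y ≠ x → ENNReal.ofReal (φ y) ≤ G.avg (fun z => ENNReal.ofReal (φ z)) y) :
    G.energy φ + 2 * (G.deg x * G.avg (fun z => ENNReal.ofReal (φ z)) x) ≤ 2 * G.deg x := by
  classical
  have key := G.energy_add_tsum φ hφ
  set h : X → ℝ≥0∞ := fun z => ENNReal.ofReal (φ z) with hh
  have hS : ∑' y, G.deg y * h y ^ 2 ≠ ∞ := by
    refine ne_top_of_le_ne_top hs (ENNReal.tsum_le_tsum fun y => ?_)
    refine mul_le_mul_right (pow_le_of_le_one zero_le ?_ two_ne_zero) _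
    exact ENNReal.ofReal_le_one.2 (hφ1 y)
  -- Termwise: off `x`, subharmonicity gives `h² ≤ h · avg h`; at `x`, where `h = 1`, the extra
  -- terms make both sides equal.
  have hST : ∑' y, G.deg y * h y ^ 2 + G.deg x * G.avg h x ≤
      ∑' y, h y * (G.deg y * G.avg h y) + G.deg x := by
    have e : ∀ c : ℝ≥0∞, c = ∑' y, if y = x then c else 0 := fun c => (tsum_ite_eq x fun _ => c).symm
    rw [e (G.deg x * G.avg h x)]
    nth_rw 2 [e (G.deg x)]
    rw [← ENNReal.tsum_add, ← ENNReal.tsum_add]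
    refine ENNReal.tsum_le_tsum fun y => ?_
    by_cases hy : y = x
    · subst hy
      have : h y = 1 := by simp [hh, hx]
      simp [this, add_comm]
    · simp only [hy, if_false, add_zero]
      rw [sq, mul_left_comm]
      exact mul_le_mul_right (mul_le_mul_right (hsub y hy) _) _
  have h2S : 2 * ∑' y, G.deg y * h y ^ 2 ≠ ∞ := ENNReal.mul_ne_top (by simp) hS
  refine (ENNReal.add_le_add_iff_left h2S).1 ?_
  calc _ = G.energy φ + 2 * (∑' y, G.deg y * h y ^ 2 + G.deg x * G.avg h x) := by ring
    _ ≤ G.energy φ + 2 * (∑' y, h y * (G.deg y * G.avg h y) + G.deg x) := by gcongr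
    _ = _ := by rw [← key]; ring

/-- As `h_{n+1} ≤ 1_x + avg h_n` and averaging preserves the total against the degree, each step
adds at most `deg x`. -/
theorem tsum_deg_mul_hitWithin_ne_top (x : X) (n : ℕ) :
    ∑' y, G.deg y * G.hitWithin x n y ≠ ∞ := by
  classical
  have e : ∑' y, (if y = x then G.deg x else 0) = G.deg x := tsum_ite_eq x _
  induction n with
  | zero =>
    refine ne_top_of_le_ne_top (G.deg_ne_top x) (le_of_eq ?_)
    rw [← e]
    refine tsum_congr fun y => ?_
    by_cases h : y = x <;> simp [hitWithin, h]
  | succ n ih =>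
    have h2 : ∑' y, (if y = x then G.deg x else 0) + ∑' y, G.deg y * G.avg (G.hitWithin x n) y
        ≠ ∞ := by
      rw [e, tsum_deg_mul_avg]
      exact ENNReal.add_ne_top.2 ⟨G.deg_ne_top x, ih⟩
    rw [← ENNReal.tsum_add] at h2
    refine ne_top_of_le_ne_top h2 (ENNReal.tsum_le_tsum fun y => ?_)
    by_cases h : y = x
    · simp [h, hitWithin_self]
    · simp [hitWithin_succ _ h]

/-- The factor `1 - avg h_n x` is the probability of no return to `x` within `n + 1` steps. -/
theorem energy_hitWithin_le (x : X) (n : ℕ) :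
    G.energy (fun y => (G.hitWithin x n y).toReal) ≤
      2 * G.deg x * (1 - G.avg (G.hitWithin x n) x) := by
  have hle := G.hitWithin_le_one x n
  have e : (fun z => ENNReal.ofReal (G.hitWithin x n z).toReal) = G.hitWithin x n :=
    funext fun z => ENNReal.ofReal_toReal (ne_top_of_le_ne_top ENNReal.one_ne_top (hle z))
  have h := G.energy_add_le (fun y => (G.hitWithin x n y).toReal) (fun _ => ENNReal.toReal_nonneg)
    (fun y => ENNReal.toReal_le_of_le_ofReal zero_le_one (by simpa using hle y)) (x := x)
    (by simp [hitWithin_self])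
    (by simpa only [congrFun e] using G.tsum_deg_mul_hitWithin_ne_top x n)
    (fun y hy => by
      rw [e, congrFun e, ← hitWithin_succ _ hy]
      exact G.hitWithin_le_succ x n y)
  rw [e] at h
  have hne : G.deg x * G.avg (G.hitWithin x n) x ≠ ∞ := ENNReal.mul_ne_top (G.deg_ne_top x)
    (ne_top_of_le_ne_top ENNReal.one_ne_top (G.avg_le_one hle x))
  rw [ENNReal.mul_sub (fun _ _ => ENNReal.mul_ne_top (by simp) (G.deg_ne_top x)), mul_one, mul_assoc]
  exact ENNReal.le_sub_of_add_le_right (ENNReal.mul_ne_top (by simp) hne) h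

theorem energy_add_le_two_mul (φ ψ : X → ℝ) :
    G.energy (φ + ψ) ≤ 2 * (G.energy φ + G.energy ψ) := by
  simp only [energy]
  rw [← ENNReal.tsum_add, ← ENNReal.tsum_mul_left]
  refine ENNReal.tsum_le_tsum fun p => ?_
  have hb := G.nonneg p.1 p.2
  rw [← ENNReal.ofReal_add (by positivity) (by positivity), ← ENNReal.ofReal_ofNat 2,
    ← ENNReal.ofReal_mul (by positivity)]
  refine ENNReal.ofReal_le_ofReal ?_
  rw [← mul_add, mul_left_comm]
  refine mul_le_mul_of_nonneg_left ?_ hb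
  simp only [Pi.add_apply]
  nlinarith [sq_nonneg ((φ p.1 - φ p.2) - (ψ p.1 - ψ p.2))]

theorem energy_neg (φ : X → ℝ) : G.energy (-φ) = G.energy φ := by
  simp only [energy, Pi.neg_apply]
  exact tsum_congr fun p => by congr 2; ring

/-- Edge by edge, a difference of maxima is at most the larger of the two differences. -/
theorem energy_sup_le (φ ψ : X → ℝ) : G.energy (φ ⊔ ψ) ≤ G.energy φ + G.energy ψ := by
  simp only [energy]
  rw [← ENNReal.tsum_add]
  refine ENNReal.tsum_le_tsum fun p => ?_
  have hb := G.nonneg p.1 p.2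
  rw [← ENNReal.ofReal_add (by positivity) (by positivity), ← mul_add]
  refine ENNReal.ofReal_le_ofReal (mul_le_mul_of_nonneg_left ?_ hb)
  simp only [Pi.sup_apply]
  rcases le_total (φ p.1) (ψ p.1) with h | h <;> rcases le_total (φ p.2) (ψ p.2) with h' | h' <;>
    simp only [sup_of_le_left, sup_of_le_right, h, h']
  · nlinarith [sq_nonneg (φ p.1 - φ p.2)]
  · rcases le_total (ψ p.1) (φ p.2) with h2 | h2 <;>
      nlinarith [sq_nonneg (φ p.1 - φ p.2), sq_nonneg (ψ p.1 - ψ p.2)]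
  · rcases le_total (φ p.1) (ψ p.2) with h2 | h2 <;>
      nlinarith [sq_nonneg (φ p.1 - φ p.2), sq_nonneg (ψ p.1 - ψ p.2)]
  · nlinarith [sq_nonneg (ψ p.1 - ψ p.2)]

theorem energy_le_tsum_deg (φ : X → ℝ) (hφ : 0 ≤ φ) :
    G.energy φ ≤ 2 * ∑' y, G.deg y * ENNReal.ofReal (φ y) ^ 2 := by
  rw [← G.energy_add_tsum φ hφ]
  exact le_self_add

/-- The set `F` has capacity zero: there are finitely supported functions of arbitrarily small
energy with values in `[0, 1]` and the value `1` on `F`. -/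
def CapacityZero (F : Set X) : Prop :=
  ∀ ε : ℝ≥0∞, ε ≠ 0 → ∃ φ : X → ℝ, φ.support.Finite ∧ 0 ≤ φ ∧ φ ≤ 1 ∧ (∀ x ∈ F, φ x = 1) ∧
    G.energy φ ≤ ε

/-- A summable function can be truncated to a finite set at an arbitrarily small cost of energy. -/
theorem exists_truncation (φ : X → ℝ) (hφ : 0 ≤ φ) (hφ1 : φ ≤ 1)
    (hs : ∑' y, G.deg y * ENNReal.ofReal (φ y) ≠ ∞) (x : X) {ε : ℝ≥0∞} (hε : ε ≠ 0) :
    ∃ s : Finset X, x ∈ s ∧ G.energy ((s : Set X).indicator φ) ≤ 2 * G.energy φ + ε := by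
  classical
  have ht := ENNReal.tendsto_tsum_compl_atTop_zero hs
  -- One factor `2` is lost in `energy_add_le_two_mul`, another in `energy_le_tsum_deg`.
  have hε4 : 0 < ε / 4 := ENNReal.div_pos hε (by simp)
  obtain ⟨s, hxs, hsε⟩ := ((eventually_ge_atTop {x}).and (ht.eventually_le_const hε4)).exists
  refine ⟨s, by simpa using hxs, ?_⟩
  have hd : (s : Set X).indicator φ = φ + -((s : Set X)ᶜ.indicator φ) := by
    rw [← sub_eq_add_neg, eq_sub_iff_add_eq, Set.indicator_self_add_compl]
  have hn : 0 ≤ (s : Set X)ᶜ.indicator φ := Set.indicator_nonneg fun y _ => hφ y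
  have h4 : G.energy ((s : Set X)ᶜ.indicator φ) ≤ 2 * (ε / 4) := by
    refine (G.energy_le_tsum_deg _ hn).trans (mul_le_mul_right (le_trans ?_ hsε) _)
    rw [← (Function.Injective.tsum_eq Subtype.val_injective (α := ℝ≥0∞)
      (f := fun y => G.deg y * ENNReal.ofReal ((s : Set X)ᶜ.indicator φ y) ^ 2)
      (g := ((↑) : {y // y ∉ s} → X)) ?_)]
    · refine ENNReal.tsum_le_tsum fun y => mul_le_mul_right ?_ _
      rw [Set.indicator_of_mem (show y.1 ∈ (s : Set X)ᶜ from y.2)]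
      exact pow_le_of_le_one zero_le (ENNReal.ofReal_le_one.2 (hφ1 y)) two_ne_zero
    · intro y hy
      by_contra hc
      apply hy
      have : y ∈ s := by simpa using hc
      simp [this]
  rw [hd]
  refine (G.energy_add_le_two_mul _ _).trans ?_
  rw [energy_neg, mul_add]
  gcongr
  calc 2 * G.energy ((s : Set X)ᶜ.indicator φ) ≤ 2 * (2 * (ε / 4)) := by gcongr
    _ = 4 * (ε / 4) := by ring
    _ = ε := ENNReal.mul_div_cancel (by simp) (by simp)

theorem IsRecurrent.capacityZero {G : WGraph X} (hG : G.IsRecurrent) (x : X) :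
    G.CapacityZero {x} := by
  intro ε hε
  have hsup := hG.iSup_avg_hitWithin x
  have hmono : Monotone fun n => G.avg (G.hitWithin x n) x :=
    monotone_nat_of_le_succ fun n => G.avg_mono (G.hitWithin_le_succ x n) x
  -- The leading factor `2` anticipates the loss in `exists_truncation`.
  have ht : Tendsto (fun n => 2 * (2 * G.deg x * (1 - G.avg (G.hitWithin x n) x))) atTop (𝓝 0) := by
    have h1 := tendsto_atTop_iSup hmono
    rw [hsup] at h1
    have h2 := ENNReal.Tendsto.sub (tendsto_const_nhds (x := (1 : ℝ≥0∞))) h1 (Or.inl (by simp))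
    have h3 := ENNReal.Tendsto.const_mul (a := 2 * G.deg x) h2
      (Or.inr (ENNReal.mul_ne_top (by simp) (G.deg_ne_top x)))
    have h4 := ENNReal.Tendsto.const_mul (a := 2) h3 (Or.inr (by simp))
    simpa using h4
  have hε2 : 0 < ε / 2 := ENNReal.div_pos hε (by simp)
  obtain ⟨n, hn⟩ := (ht.eventually_le_const hε2).exists
  have hle := G.hitWithin_le_one x n
  set φ : X → ℝ := fun y => (G.hitWithin x n y).toReal with hφdef
  have e : ∀ z, ENNReal.ofReal (φ z) = G.hitWithin x n z :=
    fun z => ENNReal.ofReal_toReal (ne_top_of_le_ne_top ENNReal.one_ne_top (hle z))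
  have hφ : 0 ≤ φ := fun _ => ENNReal.toReal_nonneg
  have hφ1 : φ ≤ 1 :=
    fun y => ENNReal.toReal_le_of_le_ofReal zero_le_one (by simpa using hle y)
  obtain ⟨s, hxs, hs⟩ := G.exists_truncation φ hφ hφ1
    (by simpa only [e] using G.tsum_deg_mul_hitWithin_ne_top x n) x hε2.ne'
  refine ⟨(s : Set X).indicator φ, s.finite_toSet.subset Set.support_indicator_subset,
    Set.indicator_nonneg fun y _ => hφ y, ?_, ?_, ?_⟩
  · exact (Set.indicator_le_self' fun y _ => hφ y).trans hφ1
  · rintro y rfl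
    simp [hxs, hφdef, hitWithin_self]
  · calc _ ≤ 2 * G.energy φ + ε / 2 := hs
      _ ≤ ε / 2 + ε / 2 := by
        gcongr
        exact le_trans (mul_le_mul_right (G.energy_hitWithin_le x n) _) hn
      _ = ε := ENNReal.add_halves ε

/-- The energy of the extension by zero of a function on a connected component. -/
theorem energy_extend (C : G.toSimpleGraph.ConnectedComponent) (φ : C.supp → ℝ) :
    G.energy (Function.extend Subtype.val φ 0) = (G.restrict C.supp).energy φ := by
  have hinj : Function.Injective (Prod.map Subtype.val Subtype.val : C.supp × C.supp → X × X) :=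
    Subtype.val_injective.prodMap Subtype.val_injective
  simp only [energy]
  rw [← hinj.tsum_eq]
  · refine tsum_congr fun p => ?_
    simp only [Prod.map_fst, Prod.map_snd, Subtype.val_injective.extend_apply]
    rfl
  · rintro ⟨y, z⟩ hp
    by_contra hc
    apply hp
    have hout : ∀ y, y ∉ C.supp → Function.extend Subtype.val φ 0 y = 0 := fun y hy =>
      Function.extend_apply' _ _ _ (by rintro ⟨v, rfl⟩; exact hy v.2)
    -- No edge of positive weight leaves a component, so pairs outside `C × C` contribute nothing.
    by_cases hb : 0 < G.b y z
    · have hadj : G.toSimpleGraph.Adj y z := hb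
      have hiff : y ∈ C.supp ↔ z ∈ C.supp := C.mem_supp_congr_adj hadj
      have hy : y ∉ C.supp := fun hy => hc ⟨(⟨y, hy⟩, ⟨z, hiff.1 hy⟩), rfl⟩
      simp [hout y hy, hout z (fun h => hy (hiff.2 h))]
    · simp [le_antisymm (not_lt.1 hb) (G.nonneg y z)]

theorem AllComponentsRecurrent.capacityZero_singleton {G : WGraph X}
    (hG : G.AllComponentsRecurrent) (x : X) : G.CapacityZero {x} := by
  intro ε hε
  set C := G.toSimpleGraph.connectedComponentMk x
  obtain ⟨φ, h1, h2, h3, h4, h5⟩ := (hG C).capacityZero ⟨x, rfl⟩ ε hε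
  refine ⟨Function.extend Subtype.val φ 0, (h1.image Subtype.val).subset ?_, ?_, ?_, ?_, ?_⟩
  · intro y hy
    by_cases hyC : ∃ v : C.supp, v.1 = y
    · obtain ⟨v, rfl⟩ := hyC
      refine ⟨v, ?_, rfl⟩
      simpa [Subtype.val_injective.extend_apply] using hy
    · exact absurd (Function.extend_apply' _ _ _ hyC) hy
  · intro y
    by_cases hyC : ∃ v : C.supp, v.1 = y
    · obtain ⟨v, rfl⟩ := hyC
      rw [Subtype.val_injective.extend_apply]; exact h2 v
    · rw [Function.extend_apply' _ _ _ hyC]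
  · intro y
    by_cases hyC : ∃ v : C.supp, v.1 = y
    · obtain ⟨v, rfl⟩ := hyC
      rw [Subtype.val_injective.extend_apply]; exact h3 v
    · rw [Function.extend_apply' _ _ _ hyC]; exact zero_le_one
  · rintro y rfl
    rw [← h4 ⟨y, rfl⟩ rfl]
    exact Subtype.val_injective.extend_apply φ 0 ⟨y, rfl⟩
  · rw [energy_extend]; exact h5

/-- The maximum of two cutoffs is `1` wherever one of them is, and energies add up by
`energy_sup_le`. -/
theorem AllComponentsRecurrent.capacityZero {G : WGraph X}
    (hG : G.AllComponentsRecurrent) (F : Finset X) : G.CapacityZero (F : Set X) := by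
  classical
  induction F using Finset.induction with
  | empty => exact fun ε _ => ⟨0, by simp, le_rfl, fun _ => zero_le_one, by simp, by simp [energy]⟩
  | insert x F _ ih =>
    intro ε hε
    have hε2 : ε / 2 ≠ 0 := (ENNReal.div_pos hε (by simp)).ne'
    obtain ⟨φ, a1, a2, a3, a4, a5⟩ := ih _ hε2
    obtain ⟨ψ, b1, b2, b3, b4, b5⟩ := hG.capacityZero_singleton x _ hε2
    refine ⟨φ ⊔ ψ, (a1.union b1).subset ?_, le_sup_of_le_left a2, sup_le a3 b3, ?_, ?_⟩
    · intro y hy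
      by_contra hc
      simp only [Set.mem_union, Function.mem_support, not_or, not_not] at hc
      exact hy (by simp [hc.1, hc.2])
    · intro y hy
      rw [Finset.coe_insert] at hy
      rcases hy with rfl | hy
      · rw [Pi.sup_apply, b4 y rfl]; exact sup_of_le_right (a3 y)
      · rw [Pi.sup_apply, a4 y hy]; exact sup_of_le_left (b3 y)
    · exact (G.energy_sup_le φ ψ).trans ((add_le_add a5 b5).trans_eq (ENNReal.add_halves ε))

end WGraph

/-! ### Cofaces, `ℓ²` and the form operator. -/

namespace WSComplex

variable {V : Type*} (K : WSComplex V)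

theorem m_simplex_pos (σ : K.Simplex) : 0 < K.m σ := K.m_pos _ σ.2.1

open Classical in
/-- The coface `v ∪ ρ` of `ρ`, for a vertex `v` of the link. -/
noncomputable def linkSimplex (ρ : K.Simplex) (v : K.link ρ) : K.Simplex :=
  ⟨insert v.1 ρ.1, v.2.2, fun h => absurd h (Finset.insert_ne_empty _ _)⟩

open Classical in
theorem linkSimplex_val (ρ : K.Simplex) (v : K.link ρ) :
    (K.linkSimplex ρ v).1 = insert v.1 ρ.1 := rfl

theorem face_linkSimplex (ρ : K.Simplex) (v : K.link ρ) : K.Face ρ (K.linkSimplex ρ v) := by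
  classical
  rw [Face, linkSimplex_val]
  exact ⟨Finset.subset_insert _ _, Finset.card_insert_of_notMem v.2.1⟩

theorem linkSimplex_injective (ρ : K.Simplex) : Function.Injective (K.linkSimplex ρ) := by
  classical
  intro v w h
  have h1 : insert v.1 ρ.1 = insert w.1 ρ.1 := congrArg Subtype.val h
  have h2 : v.1 ∈ insert w.1 ρ.1 := h1 ▸ Finset.mem_insert_self _ _
  exact Subtype.ext ((Finset.mem_insert.1 h2).resolve_right v.2.1)

theorem exists_linkSimplex {ρ τ : K.Simplex} (h : K.Face ρ τ) : ∃ v, K.linkSimplex ρ v = τ := by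
  classical
  obtain ⟨v, hv, hτ⟩ := Finset.exists_eq_insert_iff.2 ⟨h.1, h.2.symm⟩
  exact ⟨⟨v, hv, hτ ▸ τ.2.1⟩, Subtype.ext hτ⟩

/-- For `ρ = ∅` this is the condition under which `∅` belongs to `Σ`; otherwise it is local
summability. -/
theorem summable_m_linkSimplex (ρ : K.Simplex) :
    Summable fun v : K.link ρ => K.m (K.linkSimplex ρ v) := by
  classical
  by_cases h : ρ.1 = ∅
  · have hs := ρ.2.2 h
    let f : K.link ρ → {v : V // {v} ∈ K.faces} := fun v => ⟨v.1, by
      have := v.2.2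
      rwa [h, insert_empty_eq] at this⟩
    have hf : Function.Injective f := fun v w hvw =>
      Subtype.ext (congrArg (fun x : {v : V // {v} ∈ K.faces} => x.1) hvw)
    refine (hs.comp_injective hf).congr fun v => ?_
    rw [linkSimplex_val, h, insert_empty_eq]
    rfl
  · have hs := K.locally_summable ρ.1 ρ.2.1 (Finset.nonempty_iff_ne_empty.2 h)
    let f : K.link ρ → {σ : Finset V // σ ∈ K.faces ∧ ρ.1 ⊆ σ ∧ σ.card = ρ.1.card + 1} :=
      fun v => ⟨(K.linkSimplex ρ v).1, v.2.2, K.face_linkSimplex ρ v⟩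
    have hf : Function.Injective f := fun v w h =>
      K.linkSimplex_injective ρ (Subtype.ext (congrArg (fun x => x.1) h))
    refine (hs.comp_injective hf).congr fun v => ?_
    rfl

theorem summable_m_coface (ρ : K.Simplex) :
    Summable fun τ : {τ : K.Simplex // K.Face ρ τ} => K.m τ.1 := by
  let e : K.link ρ ≃ {τ : K.Simplex // K.Face ρ τ} :=
    Equiv.ofBijective (fun v => ⟨K.linkSimplex ρ v, K.face_linkSimplex ρ v⟩)
      ⟨fun v w h => K.linkSimplex_injective ρ (congrArg Subtype.val h), fun τ => by
        obtain ⟨v, hv⟩ := K.exists_linkSimplex τ.2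
        exact ⟨v, Subtype.ext hv⟩⟩
  exact e.summable_iff.1 (K.summable_m_linkSimplex ρ)

/-! ### The space `ℓ²` -/

theorem ofReal_m_mul_enorm_sq (ω : K.Fn) (σ : K.Simplex) :
    ENNReal.ofReal (K.m σ) * ‖ω σ‖ₑ ^ 2 = ENNReal.ofReal (K.m σ * ‖ω σ‖ ^ 2) := by
  rw [ENNReal.ofReal_mul (K.m_simplex_pos σ).le, ENNReal.ofReal_pow (norm_nonneg _),
    ofReal_norm]

theorem normSq_eq (ω : K.Fn) : K.normSq ω = ∑' σ : K.Simplex, ENNReal.ofReal (K.m σ * ‖ω σ‖ ^ 2) :=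
  tsum_congr fun σ => K.ofReal_m_mul_enorm_sq ω σ

theorem m_mul_norm_sq_nonneg (ω : K.Fn) (σ : K.Simplex) : 0 ≤ K.m σ * ‖ω σ‖ ^ 2 :=
  mul_nonneg (K.m_simplex_pos σ).le (sq_nonneg _)

theorem mem_l2_iff {ω : K.Fn} : ω ∈ K.l2 ↔ Summable fun σ : K.Simplex => K.m σ * ‖ω σ‖ ^ 2 := by
  change K.normSq ω < ∞ ↔ _
  rw [normSq_eq, lt_top_iff_ne_top]
  refine ⟨fun h => ?_, fun h => h.tsum_ofReal_ne_top⟩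
  refine (ENNReal.summable_toReal h).congr fun σ => ?_
  rw [ENNReal.toReal_ofReal (K.m_mul_norm_sq_nonneg ω σ)]

theorem normSq_eq_ofReal {ω : K.Fn} (h : ω ∈ K.l2) :
    K.normSq ω = ENNReal.ofReal (∑' σ : K.Simplex, K.m σ * ‖ω σ‖ ^ 2) := by
  rw [normSq_eq, ENNReal.ofReal_tsum_of_nonneg (K.m_mul_norm_sq_nonneg ω) (K.mem_l2_iff.1 h)]

/-- Use `|ω| ≤ 1 + |ω|²` and the finite total mass of the cofaces. -/
theorem l2_le_domBoundary : K.l2 ≤ K.domBoundary := by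
  intro ω hω ρ
  have h1 := (K.mem_l2_iff.1 hω).subtype {τ | K.Face ρ τ}
  refine Summable.of_nonneg_of_le (fun τ => mul_nonneg (K.m_simplex_pos τ.1).le (norm_nonneg _))
    (fun τ => ?_) ((K.summable_m_coface ρ).add h1)
  have hm := (K.m_simplex_pos τ.1).le
  simp only [Function.comp_apply]
  nlinarith [mul_nonneg hm (sq_nonneg (‖ω τ.1‖ - 1)), mul_nonneg hm (norm_nonneg (ω τ.1))]

theorem norm_l2Inner_term (f g : K.Fn) (σ : K.Simplex) :
    ‖(K.m σ : ℂ) * f σ * (starRingEnd ℂ) (g σ)‖ = K.m σ * ‖f σ‖ * ‖g σ‖ := by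
  rw [norm_mul, norm_mul, Complex.norm_real, Real.norm_of_nonneg (K.m_simplex_pos σ).le,
    RCLike.norm_conj]

theorem summable_l2Inner {f g : K.Fn} (hf : f ∈ K.l2) (hg : g ∈ K.l2) :
    Summable fun σ : K.Simplex => (K.m σ : ℂ) * f σ * (starRingEnd ℂ) (g σ) := by
  refine Summable.of_norm_bounded ((K.mem_l2_iff.1 hf).add (K.mem_l2_iff.1 hg)) fun σ => ?_
  rw [norm_l2Inner_term]
  have hm := (K.m_simplex_pos σ).le
  nlinarith [mul_nonneg hm (sq_nonneg (‖f σ‖ - ‖g σ‖)),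
    mul_nonneg hm (mul_nonneg (norm_nonneg (f σ)) (norm_nonneg (g σ)))]

theorem l2Inner_add_right {f g g' : K.Fn} (hf : f ∈ K.l2) (hg : g ∈ K.l2) (hg' : g' ∈ K.l2) :
    K.l2Inner f (g + g') = K.l2Inner f g + K.l2Inner f g' := by
  rw [l2Inner, l2Inner, l2Inner,
    ← (K.summable_l2Inner hf hg).tsum_add (K.summable_l2Inner hf hg')]
  exact tsum_congr fun σ => by simp [mul_add]

theorem l2Inner_smul_right (f g : K.Fn) (c : ℂ) :
    K.l2Inner f (c • g) = (starRingEnd ℂ) c * K.l2Inner f g := by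
  rw [l2Inner, l2Inner, ← tsum_mul_left]
  exact tsum_congr fun σ => by simp only [Pi.smul_apply, smul_eq_mul, map_mul]; ring

theorem l2Inner_ind (f : K.Fn) (τ : K.Simplex) : K.l2Inner f (K.ind τ) = K.m τ * f τ := by
  rw [l2Inner, tsum_eq_single τ]
  · simp [ind]
  · intro σ hσ
    simp [ind, hσ]

/-- The Cauchy–Schwarz inequality. -/
theorem enorm_l2Inner_sq_le {f g : K.Fn} (hf : f ∈ K.l2) (hg : g ∈ K.l2) :
    ‖K.l2Inner f g‖ₑ ^ 2 ≤ K.normSq f * K.normSq g := by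
  have hf' := K.mem_l2_iff.1 hf
  have hg' := K.mem_l2_iff.1 hg
  have key : ‖K.l2Inner f g‖ ^ 2 ≤
      (∑' σ : K.Simplex, K.m σ * ‖f σ‖ ^ 2) * ∑' σ : K.Simplex, K.m σ * ‖g σ‖ ^ 2 := by
    refine le_of_tendsto ((K.summable_l2Inner hf hg).hasSum.norm.pow 2) (Eventually.of_forall ?_)
    intro s
    have h1 : ‖∑ σ ∈ s, (K.m σ : ℂ) * f σ * (starRingEnd ℂ) (g σ)‖ ≤
        ∑ σ ∈ s, K.m σ * ‖f σ‖ * ‖g σ‖ := by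
      refine (norm_sum_le _ _).trans_eq (Finset.sum_congr rfl fun σ _ => K.norm_l2Inner_term f g σ)
    have h2 := Finset.sum_sq_le_sum_mul_sum_of_sq_le_mul s
      (r := fun σ => K.m σ * ‖f σ‖ * ‖g σ‖)
      (fun σ _ => K.m_mul_norm_sq_nonneg f σ) (fun σ _ => K.m_mul_norm_sq_nonneg g σ)
      (fun σ _ => le_of_eq (by ring))
    calc _ ≤ (∑ σ ∈ s, K.m σ * ‖f σ‖ * ‖g σ‖) ^ 2 := by gcongr
      _ ≤ _ := h2
      _ ≤ _ := mul_le_mul (hf'.sum_le_tsum s fun σ _ => K.m_mul_norm_sq_nonneg f σ)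
        (hg'.sum_le_tsum s fun σ _ => K.m_mul_norm_sq_nonneg g σ)
        (Finset.sum_nonneg fun σ _ => K.m_mul_norm_sq_nonneg g σ)
        (tsum_nonneg fun σ => K.m_mul_norm_sq_nonneg f σ)
  rw [K.normSq_eq_ofReal hf, K.normSq_eq_ofReal hg,
    ← ENNReal.ofReal_mul (tsum_nonneg fun σ => K.m_mul_norm_sq_nonneg f σ), ← ofReal_norm,
    ← ENNReal.ofReal_pow (norm_nonneg _)]
  exact ENNReal.ofReal_le_ofReal key

theorem ind_mem_l2 (τ : K.Simplex) : K.ind τ ∈ K.l2 := by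
  rw [mem_l2_iff]
  refine summable_of_ne_finset_zero (s := {τ}) fun σ hσ => ?_
  simp only [Finset.mem_singleton] at hσ
  simp [ind, hσ]

namespace Coboundary

variable {K} (δ : K.Coboundary)

theorem norm_θ {τ σ : K.Simplex} (h : K.Face τ σ) : ‖δ.θ τ σ‖ = 1 := by
  have h0 := (δ.ne_zero_iff τ σ).2 h
  rcases δ.values τ σ with h | h | h
  · simp [θ, h]
  · simp [θ, h]
  · exact absurd h h0

theorem θ_eq_zero {τ σ : K.Simplex} (h : ¬ K.Face τ σ) : δ.θ τ σ = 0 :=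
  not_not.1 fun h0 => h ((δ.ne_zero_iff τ σ).1 h0)

theorem conj_θ (τ σ : K.Simplex) : (starRingEnd ℂ) (δ.θ τ σ) = δ.θ τ σ := by
  unfold θ
  rcases δ.values τ σ with h | h | h <;> simp [h]

theorem op_ind_mem_l2 (τ : K.Simplex) : δ.op (K.ind τ) ∈ K.l2 := by
  rw [mem_l2_iff]
  have h := (summable_subtype_iff_indicator (f := fun σ : K.Simplex => K.m σ.1)
    (s := {σ | K.Face τ σ})).1 (K.summable_m_coface τ)
  refine Summable.of_nonneg_of_le (K.m_mul_norm_sq_nonneg _) (fun σ => ?_) h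
  by_cases hσ : K.Face τ σ
  · rw [Set.indicator_of_mem (show σ ∈ {σ | K.Face τ σ} from hσ)]
    have := δ.norm_θ hσ
    simp only [θ] at this
    simp [this]
  · have := δ.θ_eq_zero hσ
    simp only [θ] at this
    rw [Set.indicator_of_notMem (show σ ∉ {σ | K.Face τ σ} from hσ)]
    simp [this]

/-- `∂` is the formal adjoint of `δ`, as `θ` is real. -/
theorem l2Inner_op_ind {f : K.Fn} (hf : f ∈ K.domBoundary) (τ : K.Simplex) :
    K.l2Inner f (δ.op (K.ind τ)) = K.m τ * δ.boundary ⟨f, hf⟩ τ := by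
  have hm : (K.m τ : ℂ) ≠ 0 := by exact_mod_cast (K.m_simplex_pos τ).ne'
  have hb : δ.boundary ⟨f, hf⟩ τ = (K.m τ : ℂ)⁻¹ *
        ∑' σ : {σ : K.Simplex // K.Face τ σ}, (K.m σ.1 : ℂ) * δ.θ τ σ.1 * f σ.1 := rfl
  rw [hb, mul_inv_cancel_left₀ hm, l2Inner]
  rw [← (Subtype.val_injective (p := fun σ => K.Face τ σ)).tsum_eq]
  · refine tsum_congr fun σ => ?_
    rw [← δ.conj_θ, θ]; ring
  · intro σ hσ
    by_contra hc
    have : ¬ K.Face τ σ := fun h => hc ⟨⟨σ, h⟩, rfl⟩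
    have := δ.θ_eq_zero this
    simp only [θ] at this
    exact hσ (by simp [this])

/-- The functions in the domain of `δ` as an operator in `ℓ²` that satisfy the weak equation
`⟨f, δη⟩ = ⟨g, η⟩`. -/
def weakSolutions {f g : K.Fn} (hf : f ∈ K.l2) (hg : g ∈ K.l2) : Submodule ℂ K.Fn where
  carrier := {η | η ∈ K.l2 ∧ δ.op η ∈ K.l2 ∧ K.l2Inner f (δ.op η) = K.l2Inner g η}
  zero_mem' := ⟨K.l2.zero_mem, by simp [K.l2.zero_mem], by simp [l2Inner]⟩
  add_mem' := by
    rintro η η' ⟨h1, h2, h3⟩ ⟨h1', h2', h3'⟩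
    refine ⟨K.l2.add_mem h1 h1', ?_, ?_⟩
    · rw [map_add]; exact K.l2.add_mem h2 h2'
    · rw [map_add, K.l2Inner_add_right hf h2 h2', K.l2Inner_add_right hg h1 h1', h3, h3']
  smul_mem' := by
    rintro c η ⟨h1, h2, h3⟩
    refine ⟨K.l2.smul_mem c h1, ?_, ?_⟩
    · rw [map_smul]; exact K.l2.smul_mem c h2
    · rw [map_smul, l2Inner_smul_right, l2Inner_smul_right, h3]

theorem eq_sum_ind {u : K.Fn} (hu : (Function.support u).Finite) :
    u = ∑ τ ∈ hu.toFinset, u τ • K.ind τ := by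
  classical
  funext σ
  rw [Finset.sum_apply]
  simp only [Pi.smul_apply, ind, Set.indicator_apply, Set.mem_singleton_iff, smul_eq_mul, mul_ite,
    mul_one, mul_zero]
  rw [Finset.sum_ite_eq]
  split_ifs with h
  · rfl
  · simpa using h

theorem mem_of_finite_support (N : Submodule ℂ K.Fn) (hN : ∀ τ, K.ind τ ∈ N) {u : K.Fn}
    (hu : (Function.support u).Finite) : u ∈ N := by
  rw [eq_sum_ind hu]
  exact N.sum_mem fun τ _ => N.smul_mem _ (hN τ)

theorem mem_domD_of_finite_support {u : K.Fn} (hu : (Function.support u).Finite) :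
    u ∈ δ.domD :=
  ⟨mem_of_finite_support K.l2 K.ind_mem_l2 hu, fun _ => u, fun _ => hu, by
    simp [formPlus, normSq_zero]⟩

theorem ind_mem_domD (τ : K.Simplex) : K.ind τ ∈ δ.domD :=
  δ.mem_domD_of_finite_support ((Set.finite_singleton τ).subset Set.support_indicator_subset)

theorem op_mem_l2_of_finite_support {u : K.Fn} (hu : (Function.support u).Finite) :
    δ.op u ∈ K.l2 :=
  mem_of_finite_support (K.l2.comap δ.op) δ.op_ind_mem_l2 hu

theorem op_mem_l2_of_mem_domD {ω : K.Fn} (hω : ω ∈ δ.domD) : δ.op ω ∈ K.l2 := by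
  obtain ⟨_, u, hu, ht⟩ := hω
  obtain ⟨n, hn⟩ := (ht.eventually_lt_const (u := ∞) (by simp)).exists
  have h1 : δ.op (u n - ω) ∈ K.l2 := lt_of_le_of_lt le_add_self hn
  have h2 := K.l2.sub_mem (δ.op_mem_l2_of_finite_support (hu n)) h1
  rwa [map_sub, sub_sub_cancel] at h2

/-- Finitely supported functions are combinations of indicators and are dense in the form norm; both
sides of the weak equation are continuous in it by Cauchy–Schwarz. -/
theorem domD_le_weakSolutions {f g : K.Fn} (hf : f ∈ K.l2) (hg : g ∈ K.l2)
    (h : ∀ τ, K.l2Inner f (δ.op (K.ind τ)) = K.l2Inner g (K.ind τ)) :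
    δ.domD ≤ δ.weakSolutions hf hg := by
  intro η hη
  have hη1 := hη.1
  have hη2 := δ.op_mem_l2_of_mem_domD hη
  obtain ⟨_, u, hu, ht⟩ := hη
  refine ⟨hη1, hη2, ?_⟩
  have hw : ∀ n, u n ∈ δ.weakSolutions hf hg := fun n =>
    mem_of_finite_support (δ.weakSolutions hf hg) (fun τ => ⟨K.ind_mem_l2 τ, δ.op_ind_mem_l2 τ, h τ⟩) (hu n)
  -- As `u n` solves the equation, the defect of `η` depends on `u n - η` only; it is constant in
  -- `n`, yet bounded by a null sequence.
  have hd : ∀ n, K.l2Inner f (δ.op η) - K.l2Inner g η =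
      K.l2Inner g (u n - η) - K.l2Inner f (δ.op (u n - η)) := by
    intro n
    obtain ⟨w1, w2, w3⟩ := hw n
    have e1 : K.l2Inner g (u n) = K.l2Inner g (u n - η) + K.l2Inner g η := by
      rw [← K.l2Inner_add_right hg (K.l2.sub_mem w1 hη1) hη1, sub_add_cancel]
    have e2 : K.l2Inner f (δ.op (u n)) =
        K.l2Inner f (δ.op (u n - η)) + K.l2Inner f (δ.op η) := by
      rw [map_sub, ← K.l2Inner_add_right hf (K.l2.sub_mem w2 hη2) hη2, sub_add_cancel]
    linear_combination w3 - e2 + e1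
  have hle : ∀ n, ‖K.l2Inner f (δ.op η) - K.l2Inner g η‖ₑ ^ 2 ≤
      2 * (K.normSq g + K.normSq f) * (K.normSq (u n - η) + δ.formPlus (u n - η)) := by
    intro n
    obtain ⟨w1, w2, w3⟩ := hw n
    have c1 := K.enorm_l2Inner_sq_le hg (K.l2.sub_mem w1 hη1)
    have c2 := K.enorm_l2Inner_sq_le hf (K.l2.sub_mem w2 hη2)
    rw [← map_sub] at c2
    rw [hd n]
    have hab : ∀ a b : ℂ, ‖a - b‖ₑ ^ 2 ≤ 2 * (‖a‖ₑ ^ 2 + ‖b‖ₑ ^ 2) := by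
      intro a b
      simp only [enorm_eq_nnnorm]
      norm_cast
      exact (pow_le_pow_left₀ zero_le (nnnorm_sub_le a b) 2).trans add_sq_le
    refine (hab _ _).trans ?_
    rw [mul_assoc]
    refine mul_le_mul_right ?_ _
    rw [add_mul, mul_add, mul_add]
    exact add_le_add (c1.trans le_self_add) (c2.trans le_add_self)
  have hfg : 2 * (K.normSq g + K.normSq f) ≠ ∞ :=
    ENNReal.mul_ne_top (by simp) (ENNReal.add_lt_top.2 ⟨hg, hf⟩).ne
  have hlim := ENNReal.Tendsto.const_mul (a := 2 * (K.normSq g + K.normSq f)) ht (Or.inr hfg)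
  rw [mul_zero] at hlim
  have h0 := le_antisymm (ge_of_tendsto' hlim hle) zero_le
  rw [pow_eq_zero_iff two_ne_zero, enorm_eq_zero] at h0
  exact sub_eq_zero.1 h0

/-- Unfolds the nested domains; `δω ∈ D(∂)` is automatic for `δω ∈ ℓ²`. -/
theorem mem_graph_upLaplacianD {ω g : K.Fn} : (ω, g) ∈ δ.upLaplacianD.graph ↔
    ω ∈ δ.domD ∧ g ∈ K.l2 ∧ ∃ h : δ.op ω ∈ K.l2,
      δ.boundary ⟨δ.op ω, K.l2_le_domBoundary h⟩ = g := by
  rw [LinearPMap.mem_graph_iff]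
  constructor
  · rintro ⟨⟨y, hy⟩, rfl, rfl⟩
    have hy' := hy
    obtain ⟨⟨z, hz, rfl⟩, hy2⟩ := hy'
    obtain ⟨hz1, ⟨t, ht, hte⟩⟩ := hz.1
    refine ⟨z.2, ?_, hz1, ?_⟩
    · have : t = ⟨δ.op z.1, K.l2_le_domBoundary hz1⟩ := Subtype.ext hte
      subst this
      exact ht
    · rfl
  · rintro ⟨hω, hg, h, rfl⟩
    have hd : δ.op ω ∈ δ.boundaryN.domain :=
      ⟨⟨h, ⟨⟨δ.op ω, K.l2_le_domBoundary h⟩, hg, rfl⟩⟩, K.l2_le_domBoundary h⟩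
    exact ⟨⟨ω, ⟨⟨⟨ω, hω⟩, hd, rfl⟩, hω⟩⟩, rfl, rfl⟩

/-- `Δ⁺_D = ∂_N δ_D` is the operator associated with the closed form `Q⁺_D`. -/
theorem graph_upLaplacianD :
    (δ.upLaplacianD.graph : Set (K.Fn × K.Fn)) = δ.formOperatorGraph := by
  ext ⟨ω, g⟩
  rw [SetLike.mem_coe, mem_graph_upLaplacianD]
  constructor
  · rintro ⟨hω, hg, h, rfl⟩
    refine ⟨hω, hg, fun η hη => (δ.domD_le_weakSolutions h hg (fun τ => ?_) hη).2.2⟩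
    rw [δ.l2Inner_op_ind (K.l2_le_domBoundary h), l2Inner_ind]
  · rintro ⟨hω, hg, h⟩
    have h2 := δ.op_mem_l2_of_mem_domD hω
    refine ⟨hω, hg, h2, funext fun τ => ?_⟩
    have h3 := h _ (δ.ind_mem_domD τ)
    rw [δ.l2Inner_op_ind (K.l2_le_domBoundary h2), l2Inner_ind] at h3
    exact mul_left_cancel₀ (by exact_mod_cast (K.m_simplex_pos τ).ne') h3

end Coboundary

end WSComplex

/-! ### Approximating `δ1_ρ` by cutoffs on the link. -/

namespace WSComplex

variable {V : Type*} {K : WSComplex V}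

namespace Coboundary

variable (δ : K.Coboundary)

/-- The product of `δ 1_ρ` with a function `φ` on the link of `ρ`. -/
noncomputable def cutoff (ρ : K.Simplex) (φ : K.link ρ → ℝ) : K.Fn :=
  Function.extend (K.linkSimplex ρ) (fun v => δ.θ ρ (K.linkSimplex ρ v) * φ v) 0

theorem cutoff_linkSimplex (ρ : K.Simplex) (φ : K.link ρ → ℝ) (v : K.link ρ) :
    δ.cutoff ρ φ (K.linkSimplex ρ v) = δ.θ ρ (K.linkSimplex ρ v) * φ v :=
  (K.linkSimplex_injective ρ).extend_apply _ _ _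

theorem cutoff_of_not_face {ρ τ : K.Simplex} (h : ¬ K.Face ρ τ) (φ : K.link ρ → ℝ) :
    δ.cutoff ρ φ τ = 0 :=
  Function.extend_apply' _ _ _ (by rintro ⟨v, rfl⟩; exact h (K.face_linkSimplex ρ v))

theorem cutoff_one (ρ : K.Simplex) : δ.cutoff ρ 1 = δ.op (K.ind ρ) := by
  funext τ
  by_cases h : K.Face ρ τ
  · obtain ⟨v, rfl⟩ := K.exists_linkSimplex h
    rw [cutoff_linkSimplex]
    simp [θ]
  · rw [δ.cutoff_of_not_face h]
    exact (δ.θ_eq_zero h).symm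

theorem finite_support_cutoff (ρ : K.Simplex) {φ : K.link ρ → ℝ} (hφ : φ.support.Finite) :
    (Function.support (δ.cutoff ρ φ)).Finite := by
  refine (hφ.image (K.linkSimplex ρ)).subset fun τ hτ => ?_
  by_cases h : K.Face ρ τ
  · obtain ⟨v, rfl⟩ := K.exists_linkSimplex h
    refine ⟨v, fun hv => hτ ?_, rfl⟩
    rw [cutoff_linkSimplex, hv]
    simp
  · exact absurd (δ.cutoff_of_not_face h φ) hτ

theorem normSq_cutoff_sub (ρ : K.Simplex) (φ : K.link ρ → ℝ) :
    K.normSq (δ.cutoff ρ φ - δ.op (K.ind ρ)) =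
      ∑' v, ENNReal.ofReal (K.m (K.linkSimplex ρ v) * (φ v - 1) ^ 2) := by
  rw [normSq_eq, ← cutoff_one, ← (K.linkSimplex_injective ρ).tsum_eq]
  · refine tsum_congr fun v => ?_
    rw [Pi.sub_apply, cutoff_linkSimplex, cutoff_linkSimplex, ← mul_sub, norm_mul,
      δ.norm_θ (K.face_linkSimplex ρ v), one_mul, Pi.one_apply, ← Complex.ofReal_sub,
      Complex.norm_real, Real.norm_eq_abs, sq_abs]
  · intro τ hτ
    by_contra hc
    have h : ¬ K.Face ρ τ := fun h => hc (K.exists_linkSimplex h)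
    exact hτ (by simp [δ.cutoff_of_not_face h])

-- Among the faces of `vv'ρ`, only `vρ` and `v'ρ` contain `ρ`, and the cutoff vanishes on the
-- others.
open Classical in
theorem op_cutoff_apply {ρ σ : K.Simplex} {v v' : K.link ρ} (hne : v ≠ v')
    (hσ : σ.1 = insert v.1 (insert v'.1 ρ.1)) (φ : K.link ρ → ℝ) :
    δ.op (δ.cutoff ρ φ) σ =
      δ.θ (K.linkSimplex ρ v) σ * (δ.θ ρ (K.linkSimplex ρ v) * φ v) +
      δ.θ (K.linkSimplex ρ v') σ * (δ.θ ρ (K.linkSimplex ρ v') * φ v') := by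
  have hne' : v.1 ≠ v'.1 := fun h => hne (Subtype.ext h)
  have hne2 : K.linkSimplex ρ v ≠ K.linkSimplex ρ v' := fun h => hne (K.linkSimplex_injective ρ h)
  rw [← cutoff_linkSimplex, ← cutoff_linkSimplex, δ.action,
    ← Finset.sum_pair (f := fun τ => δ.θ τ σ * δ.cutoff ρ φ τ) hne2]
  symm
  refine Finset.sum_subset ?_ ?_
  · intro τ hτ
    rw [facesOf, Set.Finite.mem_toFinset]
    rw [Finset.mem_insert, Finset.mem_singleton] at hτ
    have hcard : σ.1.card = ρ.1.card + 1 + 1 := by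
      rw [hσ, Finset.card_insert_of_notMem, Finset.card_insert_of_notMem v'.2.1]
      rw [Finset.mem_insert, not_or]
      exact ⟨hne', v.2.1⟩
    rcases hτ with rfl | rfl
    · refine ⟨?_, by rw [hcard, (K.face_linkSimplex ρ v).2]⟩
      rw [hσ, linkSimplex_val]
      exact Finset.insert_subset_insert _ (Finset.subset_insert _ _)
    · refine ⟨?_, by rw [hcard, (K.face_linkSimplex ρ v').2]⟩
      rw [hσ, linkSimplex_val]
      exact Finset.subset_insert _ _
  · intro τ hτ hτ'
    rw [facesOf, Set.Finite.mem_toFinset] at hτ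
    rw [Finset.mem_insert, Finset.mem_singleton, not_or] at hτ'
    by_cases h : K.Face ρ τ
    · obtain ⟨w, rfl⟩ := K.exists_linkSimplex h
      have hw : w.1 ∈ σ.1 := hτ.1 (by rw [linkSimplex_val]; exact Finset.mem_insert_self _ _)
      rw [hσ, Finset.mem_insert, Finset.mem_insert] at hw
      rcases hw with hw | hw | hw
      · exact absurd (congrArg (K.linkSimplex ρ) (Subtype.ext hw)) hτ'.1
      · exact absurd (congrArg (K.linkSimplex ρ) (Subtype.ext hw)) hτ'.2
      · exact absurd hw w.2.1
    · rw [δ.cutoff_of_not_face h, mul_zero]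

-- The case `φ = 1` together with `δδ = 0` shows that the two sign products are opposite, so a
-- common sign factors out of `φ v - φ v'`.
open Classical in
theorem norm_op_cutoff_sq {ρ σ : K.Simplex} {v v' : K.link ρ} (hne : v ≠ v')
    (hσ : σ.1 = insert v.1 (insert v'.1 ρ.1)) (φ : K.link ρ → ℝ) :
    ‖δ.op (δ.cutoff ρ φ) σ‖ ^ 2 = (φ v - φ v') ^ 2 := by
  have h1 := δ.op_cutoff_apply hne hσ 1
  rw [cutoff_one, δ.op_op] at h1
  simp only [Pi.zero_apply, Pi.one_apply, Complex.ofReal_one, mul_one] at h1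
  have h2 : δ.op (δ.cutoff ρ φ) σ = δ.θ (K.linkSimplex ρ v) σ * δ.θ ρ (K.linkSimplex ρ v) *
      ((φ v - φ v' : ℝ) : ℂ) := by
    rw [δ.op_cutoff_apply hne hσ φ]
    push_cast
    linear_combination -(φ v' : ℂ) * h1
  have hf : K.Face (K.linkSimplex ρ v) σ := by
    refine ⟨?_, ?_⟩
    · rw [hσ, linkSimplex_val]
      exact Finset.insert_subset_insert _ (Finset.subset_insert _ _)
    · rw [hσ, linkSimplex_val, Finset.card_insert_of_notMem, Finset.card_insert_of_notMem v'.2.1,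
        Finset.card_insert_of_notMem v.2.1]
      rw [Finset.mem_insert, not_or]
      exact ⟨fun h => hne (Subtype.ext h), v.2.1⟩
  rw [h2, norm_mul, norm_mul, δ.norm_θ hf, δ.norm_θ (K.face_linkSimplex ρ v), one_mul, one_mul,
    Complex.norm_real, Real.norm_eq_abs, sq_abs]

open Classical in
theorem exists_pair_of_op_cutoff_ne_zero {ρ σ : K.Simplex} {φ : K.link ρ → ℝ}
    (h : δ.op (δ.cutoff ρ φ) σ ≠ 0) :
    ∃ p : K.link ρ × K.link ρ, p.1 ≠ p.2 ∧ σ.1 = insert p.1.1 (insert p.2.1 ρ.1) := by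
  rw [δ.action] at h
  obtain ⟨τ, hτ, h0⟩ := Finset.exists_ne_zero_of_sum_ne_zero h
  rw [facesOf, Set.Finite.mem_toFinset] at hτ
  have hρτ : K.Face ρ τ := by
    by_contra hc
    exact h0 (by rw [δ.cutoff_of_not_face hc, mul_zero])
  obtain ⟨v, rfl⟩ := K.exists_linkSimplex hρτ
  obtain ⟨w, rfl⟩ := K.exists_linkSimplex hτ
  have hw := w.2.1
  rw [linkSimplex_val, Finset.mem_insert, not_or] at hw
  have hwl : w.1 ∈ K.link ρ := by
    refine ⟨hw.2, K.down_closed _ w.2.2 _ ?_⟩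
    rw [linkSimplex_val]
    exact Finset.insert_subset_insert _ (Finset.subset_insert _ _)
  refine ⟨(⟨w.1, hwl⟩, v), fun h => hw.1 (congrArg Subtype.val h), ?_⟩
  rw [linkSimplex_val, linkSimplex_val]

/-- The form `Q⁺` at `φ · δ 1_ρ` is controlled by the energy of `φ` on the link. -/
theorem formPlus_cutoff_le (ρ : K.Simplex) (φ : K.link ρ → ℝ) :
    δ.formPlus (δ.cutoff ρ φ) ≤ (K.linkGraph ρ).energy φ := by
  classical
  set S : Set K.Simplex := {σ | δ.op (δ.cutoff ρ φ) σ ≠ 0}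
  -- One ordered pair per simplex of the support, which it determines. The energy runs over both
  -- orders, hence only an inequality.
  choose p hp1 hp2 using fun σ : S => δ.exists_pair_of_op_cutoff_ne_zero σ.2
  have hinj : Function.Injective p := fun σ σ' h =>
    Subtype.ext (Subtype.ext (by rw [hp2 σ, hp2 σ', h]))
  rw [formPlus, normSq_eq, ← (Subtype.val_injective (p := fun σ => σ ∈ S)).tsum_eq]
  · refine le_trans (ENNReal.tsum_le_tsum fun σ => ?_) (ENNReal.tsum_comp_le_tsum_of_injective hinj
      fun q => ENNReal.ofReal ((K.linkGraph ρ).b q.1 q.2 * (φ q.1 - φ q.2) ^ 2))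
    have hb : (K.linkGraph ρ).b (p σ).1 (p σ).2 = K.m σ.1 := by
      change K.linkWeight ρ (p σ).1 (p σ).2 = _
      rw [linkWeight, ← hp2 σ, if_pos ⟨hp1 σ, σ.1.2.1⟩]
    rw [hb, δ.norm_op_cutoff_sq (hp1 σ) (hp2 σ)]
  · intro σ hσ
    by_contra hc
    have : δ.op (δ.cutoff ρ φ) σ = 0 := by
      by_contra h
      exact hc ⟨⟨σ, h⟩, rfl⟩
    exact hσ (by simp [this])

/-- A finite `s` carries all but `ε / 2` of the mass of the cofaces; a cutoff equal to `1` on `s`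
with energy at most `ε / 2` does the rest, as `δδ1_ρ = 0`. -/
theorem exists_finite_support_approx {ρ : K.Simplex}
    (hρ : (K.linkGraph ρ).AllComponentsRecurrent) {ε : ℝ≥0∞} (hε : ε ≠ 0) :
    ∃ u : K.Fn, (Function.support u).Finite ∧
      K.normSq (u - δ.op (K.ind ρ)) + δ.formPlus (u - δ.op (K.ind ρ)) ≤ ε := by
  classical
  have hε2 : 0 < ε / 2 := ENNReal.div_pos hε (by simp)
  have hs := (K.summable_m_linkSimplex ρ).tsum_ofReal_ne_top
  obtain ⟨s, hs⟩ :=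
    ((ENNReal.tendsto_tsum_compl_atTop_zero hs).eventually_le_const hε2).exists
  obtain ⟨φ, h1, h2, h3, h4, h5⟩ := hρ.capacityZero s _ hε2.ne'
  refine ⟨δ.cutoff ρ φ, δ.finite_support_cutoff ρ h1, ?_⟩
  rw [← ENNReal.add_halves ε]
  refine add_le_add ?_ ?_
  · rw [normSq_cutoff_sub]
    refine le_trans ?_ hs
    rw [← (Subtype.val_injective (p := fun v => v ∉ s)).tsum_eq]
    · refine ENNReal.tsum_le_tsum fun v => ENNReal.ofReal_le_ofReal ?_
      refine mul_le_of_le_one_right (K.m_simplex_pos _).le ?_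
      have a := h2 v.1
      have b := h3 v.1
      simp only [Pi.zero_apply, Pi.one_apply] at a b
      nlinarith
    · intro v hv
      by_contra hc
      have hvs : v ∈ s := by simpa using hc
      exact hv (by simp [h4 v hvs])
  · rw [formPlus, map_sub, δ.op_op, sub_zero]
    exact (δ.formPlus_cutoff_le ρ φ).trans h5

theorem op_ind_mem_domD {ρ : K.Simplex} (hρ : (K.linkGraph ρ).AllComponentsRecurrent) :
    δ.op (K.ind ρ) ∈ δ.domD := by
  refine ⟨δ.op_ind_mem_l2 ρ, ?_⟩
  choose u hu hu' using fun n : ℕ => δ.exists_finite_support_approx hρ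
    (ε := (n + 1 : ℝ≥0∞)⁻¹) (by simp)
  refine ⟨u, hu, tendsto_of_tendsto_of_tendsto_of_le_of_le tendsto_const_nhds ?_
    (fun _ => zero_le) hu'⟩
  have := (tendsto_add_atTop_iff_nat 1).2 ENNReal.tendsto_inv_nat_nhds_zero
  simpa using this

end Coboundary

end WSComplex

theorem mainTheorem7 {V : Type*} (K : WSComplex V) (δ : K.Coboundary) :
    -- `Δ⁺_D = ∂_N δ_D` is the operator associated with the closed form `Q⁺_D`
    ((δ.upLaplacianD.graph : Set (K.Fn × K.Fn)) = δ.formOperatorGraph) ∧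
    ∀ ρ : K.Simplex, (K.linkGraph ρ).AllComponentsRecurrent →
      ∃ h : K.ind ρ ∈ δ.coboundaryD.domain,
        δ.coboundaryD ⟨K.ind ρ, h⟩ ∈ δ.coboundaryD.domain ∧
        ((∃ τ : K.Simplex, K.Face ρ τ) →
          IsHarmonicEigenfunction δ.upLaplacianD (δ.coboundaryD ⟨K.ind ρ, h⟩)) := by
  refine ⟨δ.graph_upLaplacianD, fun ρ hρ => ⟨δ.ind_mem_domD ρ, δ.op_ind_mem_domD hρ, ?_⟩⟩
  rintro ⟨τ, hτ⟩
  refine ⟨fun h => (δ.ne_zero_iff ρ τ).2 hτ (congrFun h τ), ?_⟩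
  have hg : (δ.op (K.ind ρ), (0 : K.Fn)) ∈ (δ.upLaplacianD.graph : Set (K.Fn × K.Fn)) := by
    rw [δ.graph_upLaplacianD]
    refine ⟨δ.op_ind_mem_domD hρ, K.l2.zero_mem, fun η _ => ?_⟩
    -- The weak equation with `g = 0` is trivial: its left side pairs `δδ1_ρ = 0` with `δη`.
    simp [WSComplex.l2Inner, δ.op_op]
  obtain ⟨⟨y, hy⟩, rfl, hy2⟩ := (LinearPMap.mem_graph_iff _).1 hg
  exact ⟨hy, hy2⟩
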